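/- Let $I=[0,1)$ and let $\lambda,\mu,\delta$ be real numbers with $0<\lambda<1$, $\mu>0$ and $1-\lambda<\delta<d_{\lambda,\mu}$, where $d_{\lambda,\mu}=1$ if $\lambda\mu<1$ and $d_{\lambda,\mu}=\frac{\mu-\lambda\mu}{\mu-1}$ if $\lambda\mu\ge 1$. Put $\eta=\frac{1-\delta}{\lambda}$ and let $f:I\to I$ be given by $f(x)=\lambda x+\delta$ for $0\le x<\eta$ and $f(x)=\mu(\lambda x+\delta-1)$ for $\eta\le x<1$. Let $r_{\lambda,\mu}=1$ if $\lambda\mu<1$ and $r_{\lambda,\mu}=-\frac{\log\lambda}{\log\mu}$ if $\lambda\mu\ge1$. For $0<\rho<r_{\lambda,\mu}$ set $$\sigma(\lambda,\mu,\rho)=\sum_{k\ge1}\bigl(\lfloor (k+1)\rho\rfloor-\lfloor k\rho\rfloor\bigr)\lambda^k\mu^{\lfloor k\rho\rfloor},\qquad \delta(\lambda,\mu,\rho)=\frac{(1-\lambda)(1+\mu\sigma(\lambda,\mu,\rho))}{1+(\mu-1)\sigma(\lambda,\mu,\rho)},$$ and let $\delta(\lambda,\mu,\rho^-)$ denote the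 left limit of $\delta(\lambda,\mu,\cdot)$ at $\rho$. Let $p,q$ be relatively prime positive integers with $0<p/q<r_{\lambda,\mu}$ and assume $$\delta(\lambda,\mu,(p/q)^-)\le\delta<\delta(\lambda,\mu,p/q).$$ Put $$\phi(y)=\lfloor y\rfloor+\frac{1-\delta}{\lambda}+\sum_{k\ge0}\lambda^k\mu^{\lfloor y\rfloor-\lfloor y-kp/q\rfloor}\Bigl(\frac{\lambda+\delta-1}{\lambda}+\Bigl\lfloor y-(k+1)\frac pq\Bigr\rfloor-\Bigl\lfloor y-k\frac pq\Bigr\rfloor\Bigr),$$ let $\zeta_m=\phi(m/q)$ for $0\le m\le q-1$, and extend $(\zeta_m)$ to all $m\in\mathbb Z$ by $q$-periodicity. For distinct $a,b\in I$, let $[a,b)$ be the circular interval, that is the usual interval $[a,b)$ if $a<b$, and $[0,b)\cup[a,1)$ if $a>b$. For $l\ge1$, write $f^l(1^-)$ for the left limit of the iterate $f^l$ at $1$. Then, for every integer $l\ge1$, the limit $f^l(1^-)$ exists and belongs to $I$, and the circular interval (the $l$-th hole) $[f^l(1^-),f^l(0))$ is contained in $[\zeta_{lp-1},\zeta_{lp})$,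 where $\zeta_{lp-1}=f^l(\zeta_{q-1})$ and $\zeta_{lp}=f^l(\zeta_0)$. We have $f^l(1^-)<f^l(0)$ when $l$ is not divisible by $q$, and $f^l(1^-)>f^l(0)$ when $l$ is a multiple of $q$. Moreover $$f^n(I)=I\setminus\bigcup_{l=1}^n[f^l(1^-),f^l(0))\quad\text{when }0\le n\le q-1,$$ $$f^n(I)=I\setminus\bigcup_{l=n-q+1}^n[f^l(1^-),f^l(0))\quad\text{when }n\ge q,$$ where in both formulae the holes in the union are pairwise disjoint. Finally, for every integer $n\ge0$, the set $f^n(I)$ has Lebesgue measure at most $(\lambda^q\mu^p)^{\lfloor n/q\rfloor}$. -/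

import Mathlib

open Set Filter Topology MeasureTheory

noncomputable section

namespace TwoIntervalMap

/-- The upper bound `d_{lam,mu}` for the parameter `delta`. -/
def dBound (lam mu : ℝ) : ℝ :=
  if lam * mu < 1 then 1 else (mu - lam * mu) / (mu - 1)

/-- The upper bound `r_{lam,mu}` for rotation numbers. -/
def rBound (lam mu : ℝ) : ℝ :=
  if lam * mu < 1 then 1 else -Real.log lam / Real.log mu

/-- The critical point `eta = (1 - delta) / lam`. -/
def eta (lam delta : ℝ) : ℝ := (1 - delta) / lam

/-- The 2-interval piecewise affine map `f_{lam,mu,delta}`, given by its two formulae. Only its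
values on the unit interval `[0,1)`, which it maps to itself (see `mapsTo_affMap`), matter. -/
def affMap (lam mu delta : ℝ) (x : ℝ) : ℝ :=
  if x < eta lam delta then lam * x + delta else mu * (lam * x + delta - 1)

theorem mapsTo_affMap {lam mu delta : ℝ} (hlam0 : 0 < lam) (hlam1 : lam < 1) (hmu : 0 < mu)
    (hdelta0 : 1 - lam < delta) (hdelta1 : delta < dBound lam mu) :
    MapsTo (affMap lam mu delta) (Ico 0 1) (Ico 0 1) := by
  have key : delta < 1 ∧ mu * (lam + delta - 1) < 1 := by
    unfold dBound at hdelta1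
    split_ifs at hdelta1 with h
    · exact ⟨hdelta1, by nlinarith⟩
    · have h1 : 1 < mu := by nlinarith
      have h2 : delta * (mu - 1) < mu - lam * mu := by
        rwa [lt_div_iff₀ (by linarith)] at hdelta1
      have h3 : delta < 1 := by nlinarith
      exact ⟨h3, by nlinarith⟩
  rintro x ⟨hx0, hx1⟩
  unfold affMap eta
  split_ifs with h
  · rw [lt_div_iff₀ hlam0] at h
    exact ⟨by nlinarith, by nlinarith⟩
  · rw [not_lt, div_le_iff₀ hlam0] at h
    refine ⟨mul_nonneg hmu.le (by linarith), lt_of_le_of_lt ?_ key.2⟩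
    exact mul_le_mul_of_nonneg_left (by nlinarith) hmu.le

/-- The series `sigma(lam,mu,rho) = ∑_{k ≥ 1} (⌊(k+1) rho⌋ - ⌊k rho⌋) lam^k mu^⌊k rho⌋`,
with summation index shifted by one. -/
def sigmaSeries (lam mu rho : ℝ) : ℝ :=
  ∑' k : ℕ, ((⌊((k : ℝ) + 2) * rho⌋ - ⌊((k : ℝ) + 1) * rho⌋ : ℤ) : ℝ) * lam ^ (k + 1) *
    mu ^ ⌊((k : ℝ) + 1) * rho⌋

/-- The function `delta(lam,mu,rho)`. -/
def deltaFun (lam mu rho : ℝ) : ℝ :=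
  (1 - lam) * (1 + mu * sigmaSeries lam mu rho) / (1 + (mu - 1) * sigmaSeries lam mu rho)

/-- The left limit `delta(lam,mu,rho⁻)` of `delta(lam,mu,·)` at `rho`. -/
def deltaFunLeft (lam mu rho : ℝ) : ℝ := Function.leftLim (fun t => deltaFun lam mu t) rho

/-- The conjugation function `phi_{lam,mu,delta,rho}`. -/
def phi (lam mu delta rho : ℝ) (y : ℝ) : ℝ :=
  (⌊y⌋ : ℝ) + (1 - delta) / lam +
    ∑' k : ℕ, lam ^ k * mu ^ (⌊y⌋ - ⌊y - (k : ℝ) * rho⌋) *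
      ((lam + delta - 1) / lam +
        ((⌊y - ((k : ℝ) + 1) * rho⌋ - ⌊y - (k : ℝ) * rho⌋ : ℤ) : ℝ))

/-- The `q`-periodic sequence `zeta_m`, equal to `phi_{lam,mu,delta,p/q}(m/q)` for
`0 ≤ m ≤ q - 1`. -/
def zeta (lam mu delta : ℝ) (p q : ℕ) (m : ℤ) : ℝ :=
  phi lam mu delta ((p : ℝ) / q) (((m % (q : ℤ) : ℤ) : ℝ) / q)

/-- The left limit `f^l(1⁻)` of the `l`-th iterate of `f` at `1`. -/
def iterLeftOne (lam mu delta : ℝ) (l : ℕ) : ℝ := Function.leftLim ((affMap lam mu delta)^[l]) 1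

/-- The circular interval `[a,b)` in the circle `[0,1)`, for distinct points `a`, `b` of `[0,1)`
(by convention empty if `a = b`). -/
def circIco (a b : ℝ) : Set ℝ :=
  if a < b then Ico a b else if b < a then Ico 0 b ∪ Ico a 1 else ∅

/-- The `l`-th hole, the circular interval `[f^l(1⁻), f^l(0))`. -/
def hole (lam mu delta : ℝ) (l : ℕ) : Set ℝ :=
  circIco (iterLeftOne lam mu delta l) ((affMap lam mu delta)^[l] 0)

end TwoIntervalMap

end

open TwoIntervalMap

open TwoIntervalMap

namespace TwoIntervalMap

/-! The points `zeta_m` form a periodic orbit `ζ_0 < ⋯ < ζ_{q-1}` in `[0,1)` on which `f` acts as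
the rotation `m ↦ m + p` modulo `q`. Everything else follows from comparing other orbits with this
one.

To see that they do, write the series for `(1-λ)φ(m/q)` as `δ - (δ - μ(λ+δ-1)) J_m`, where `J_m` is
a weighted sum of the increments of an integer sequence (`one_sub_mul_series`). Shifting the index
of `J_m` gives the rotation relation (`phi_add_of_lt`, `phi_add_of_le`). Summation by parts gives
strict monotonicity in `m` (`jumpSum_lt`). The sums `J_{q-1}` and `J_0` are expressed through `σ` at
`p/q` and its left limit there, so that the two bounds on `δ` give `ζ_{q-1} < 1` and `0 ≤ ζ_0`.

A point whose iterates stay on the same side of the discontinuity `η` as those of `ζ_N` satisfies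
`f^l(x) = ζ_{N+lp} + λ^l μ^{⌊(N+lp)/q⌋} (x - ζ_N)`. Points of `[ζ_{q-1},1)` follow `ζ_{q-1}`, and
points of `[0,ζ_0]` follow `ζ_0`, which gives explicit ends for the holes and places each hole
between neighbouring orbit points.

The map is injective and `f(I) = I \ H_1`. It sends `H_l` to `H_{l+1}`, except that for `q ∣ l` one
has `H_{l+1} = H_1 ∪ f(H_l)`. Hence after `q` steps new holes absorb old ones, and the last `q`
holes suffice.

For the measure, every point of `I` follows some `ζ_M` forever, so `f^q` agrees there with the
homothety of centre `ζ_M` and ratio `λ^q μ^p < 1`. -/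

theorem mu_mul_lt_delta {lam mu delta : ℝ} (hlam1 : lam < 1) (hmu : 0 < mu)
    (hdelta0 : 1 - lam < delta) (hdelta1 : delta < dBound lam mu) :
    delta < 1 ∧ mu * (lam + delta - 1) < delta := by
  unfold dBound at hdelta1
  split_ifs at hdelta1 with h
  · refine ⟨hdelta1, ?_⟩
    rcases le_total mu 1 with hm | hm <;> nlinarith
  · have h1 : 1 < mu := by nlinarith
    have h2 : delta * (mu - 1) < mu - lam * mu := by
      rwa [lt_div_iff₀ (by linarith)] at hdelta1
    exact ⟨by nlinarith, by nlinarith⟩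

/-! ### Bounds on the rotation number and the dominating geometric series -/

theorem lt_one_of_lt_rBound {lam mu rho : ℝ} (hlam0 : 0 < lam) (hlam1 : lam < 1)
    (h : rho < rBound lam mu) : rho < 1 := by
  unfold rBound at h
  split_ifs at h with h1
  · exact h
  · have hm : 1 < mu := by nlinarith
    refine h.trans_le ?_
    rw [div_le_one (Real.log_pos hm), neg_le_iff_add_nonneg,
      ← Real.log_mul (by positivity) hlam0.ne', mul_comm]
    exact Real.log_nonneg (not_lt.1 h1)

/-- The ratio of the geometric series that dominates all the series in this file. -/
noncomputable def ratio (lam mu rho : ℝ) : ℝ := lam * max 1 mu ^ rho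

theorem ratio_pos {lam : ℝ} (mu rho : ℝ) (hlam0 : 0 < lam) : 0 < ratio lam mu rho := by
  unfold ratio; positivity

theorem ratio_lt_one {lam mu rho : ℝ} (hlam0 : 0 < lam) (hlam1 : lam < 1)
    (h : rho < rBound lam mu) : ratio lam mu rho < 1 := by
  have hr1 := lt_one_of_lt_rBound hlam0 hlam1 h
  unfold ratio
  rcases le_or_gt mu 1 with hm | hm
  · rw [max_eq_left hm, Real.one_rpow, mul_one]; exact hlam1
  · rw [max_eq_right hm.le]
    unfold rBound at h
    split_ifs at h with h1
    · refine lt_of_le_of_lt ?_ h1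
      have := Real.rpow_le_rpow_of_exponent_le hm.le hr1.le
      rw [Real.rpow_one] at this
      exact mul_le_mul_of_nonneg_left this hlam0.le
    · rw [lt_div_iff₀ (Real.log_pos hm)] at h
      have hp : 0 < mu ^ rho := by positivity
      rw [← Real.log_neg_iff (by positivity), Real.log_mul hlam0.ne' hp.ne',
        Real.log_rpow (by linarith)]
      linarith

theorem weight_le {lam mu rho C : ℝ} {k n : ℕ} (hlam0 : 0 < lam) (hmu : 0 < mu)
    (h : (n : ℝ) ≤ k * rho + C) :
    lam ^ k * mu ^ n ≤ max 1 mu ^ C * ratio lam mu rho ^ k := by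
  have hM : (0 : ℝ) < max 1 mu := by positivity
  have h1 : mu ^ n ≤ max 1 mu ^ n := pow_le_pow_left₀ hmu.le (le_max_right _ _) _
  have h2 : max 1 mu ^ n ≤ max 1 mu ^ (k * rho + C) := by
    rw [← Real.rpow_natCast]
    exact Real.rpow_le_rpow_of_exponent_le (le_max_left _ _) h
  have h3 : max 1 mu ^ (k * rho + C) = (max 1 mu ^ rho) ^ k * max 1 mu ^ C := by
    rw [Real.rpow_add hM, mul_comm (k : ℝ), Real.rpow_mul_natCast hM.le]
  unfold ratio
  rw [mul_pow]
  calc lam ^ k * mu ^ n ≤ lam ^ k * ((max 1 mu ^ rho) ^ k * max 1 mu ^ C) := by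
        rw [← h3]; exact mul_le_mul_of_nonneg_left (h1.trans h2) (by positivity)
    _ = _ := by ring

/-- The slope of `f^q` along the orbit is at most the `q`-th power of `ratio`, because `p = q ·
(p/q)` exactly. -/
theorem slope_lt_one {lam mu : ℝ} {p q : ℕ} (hlam0 : 0 < lam) (hlam1 : lam < 1) (hmu : 0 < mu)
    (hq : 0 < q) (h : (p : ℝ) / q < rBound lam mu) : lam ^ q * mu ^ p < 1 := by
  have h1 := weight_le (lam := lam) (mu := mu) (rho := (p : ℝ) / q) (C := 0) (k := q) (n := p)
    hlam0 hmu (by rw [add_zero, mul_div_cancel₀]; positivity)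
  refine h1.trans_lt ?_
  rw [Real.rpow_zero, one_mul]
  exact pow_lt_one₀ (ratio_pos _ _ hlam0).le (ratio_lt_one hlam0 hlam1 h) hq.ne'

/-- A sequence of naturals that increases by at most one at each step. -/
def IsStepSeq (a : ℕ → ℕ) : Prop := ∀ k, a (k + 1) = a k ∨ a (k + 1) = a k + 1

/-- The weighted sum of the increments of a sequence `a`. -/
noncomputable def jumpSum (lam mu : ℝ) (a : ℕ → ℕ) : ℝ :=
  ∑' k : ℕ, ((a (k + 1) : ℝ) - a k) * (lam ^ k * mu ^ a k)

/-! ### Weighted sums of the increments of a step sequence -/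

section Series

variable {lam mu : ℝ} {a : ℕ → ℕ}

theorem summable_jump (hlam0 : 0 < lam) (hmu : 0 < mu) (ha : IsStepSeq a)
    (hs : Summable fun k => lam ^ k * mu ^ a k) :
    Summable fun k => ((a (k + 1) : ℝ) - a k) * (lam ^ k * mu ^ a k) := by
  refine Summable.of_nonneg_of_le (fun k => ?_) (fun k => ?_) hs <;>
  · have : 0 < lam ^ k * mu ^ a k := by positivity
    rcases ha k with h | h <;> rw [h] <;> push_cast <;> simp [this.le]

theorem jumpSum_eq_add (hlam0 : 0 < lam) (hmu : 0 < mu) (ha : IsStepSeq a)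
    (hs : Summable fun k => lam ^ k * mu ^ a k) :
    jumpSum lam mu a = ((a 1 : ℝ) - a 0) * mu ^ a 0 +
      lam * jumpSum lam mu fun k => a (k + 1) := by
  unfold jumpSum
  rw [(summable_jump hlam0 hmu ha hs).tsum_eq_zero_add, ← tsum_mul_left]
  congr 1
  · simp
  · exact tsum_congr fun k => by ring

/-- For increments in `{0, 1}`, `μ^{a(k+1)} - μ^{a(k)} = (μ-1)(a(k+1)-a(k)) μ^{a(k)}`; multiply by
`λ^{k+1}` and sum. -/
theorem one_sub_mul_tsum (hlam0 : 0 < lam) (hmu : 0 < mu) (ha : IsStepSeq a)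
    (hs : Summable fun k => lam ^ k * mu ^ a k) :
    (1 - lam) * ∑' k, lam ^ k * mu ^ a k = mu ^ a 0 + lam * ((mu - 1) * jumpSum lam mu a) := by
  have h1 := hs.tsum_eq_zero_add
  have h2 : ∑' k, lam ^ (k + 1) * mu ^ a (k + 1) =
      lam * (mu - 1) * jumpSum lam mu a + lam * ∑' k, lam ^ k * mu ^ a k := by
    unfold jumpSum
    rw [← tsum_mul_left, ← tsum_mul_left,
      ← ((summable_jump hlam0 hmu ha hs).mul_left _).tsum_add (hs.mul_left _)]
    refine tsum_congr fun k => ?_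
    rcases ha k with h | h <;> rw [h] <;> push_cast <;> ring
  rw [h2] at h1
  simp only [pow_zero, one_mul] at h1
  linarith

/-- Makes the series of `phi` an affine function of a single jump sum. The coefficient `δ -
μ(λ+δ-1)` is the jump from `f(1⁻)` to `f(0)`, positive by `mu_mul_lt_delta`. -/
theorem one_sub_mul_series (delta : ℝ) (hlam0 : 0 < lam) (hmu : 0 < mu) (ha : IsStepSeq a)
    (h0 : a 0 = 0) (hs : Summable fun k => lam ^ k * mu ^ a k) :
    (1 - lam) * ((1 - delta) / lam + ∑' k, lam ^ k * mu ^ a k *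
      ((lam + delta - 1) / lam + ((a k : ℝ) - a (k + 1)))) =
      delta - (delta - mu * (lam + delta - 1)) * jumpSum lam mu a := by
  have h1 : ∑' k, lam ^ k * mu ^ a k *
      ((lam + delta - 1) / lam + ((a k : ℝ) - a (k + 1))) =
      (lam + delta - 1) / lam * ∑' k, lam ^ k * mu ^ a k - jumpSum lam mu a := by
    unfold jumpSum
    rw [← tsum_mul_left, ← (hs.mul_left _).tsum_sub (summable_jump hlam0 hmu ha hs)]
    exact tsum_congr fun k => by ring
  have h2 := one_sub_mul_tsum hlam0 hmu ha hs
  rw [h0, pow_zero] at h2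
  rw [h1]
  have h3 : (1 - lam) * ((1 - delta) / lam + ((lam + delta - 1) / lam *
      ∑' k, lam ^ k * mu ^ a k - jumpSum lam mu a)) = (1 - lam) * ((1 - delta) / lam) +
      (lam + delta - 1) / lam * ((1 - lam) * ∑' k, lam ^ k * mu ^ a k) -
      (1 - lam) * jumpSum lam mu a := by ring
  rw [h3, h2]
  field_simp
  ring

/-- The quantity equals `(1-λ)` times a series of positive terms. It is the denominator of
`deltaFun` or of its left limit. -/
theorem one_add_mul_jumpSum_pos (hlam0 : 0 < lam) (hlam1 : lam < 1) (hmu : 0 < mu)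
    (ha : IsStepSeq a) (h0 : a 0 = 0) (hs : Summable fun k => lam ^ k * mu ^ a k) :
    0 < 1 + (mu - 1) * (lam * jumpSum lam mu a) := by
  have h := one_sub_mul_tsum hlam0 hmu ha hs
  rw [h0, pow_zero] at h
  have h1 : 0 < ∑' k, lam ^ k * mu ^ a k :=
    hs.tsum_pos (fun k => by positivity) 0 (by positivity)
  have := mul_pos (sub_pos.2 hlam1) h1
  linarith

theorem sum_pow_mul_diff (lam : ℝ) (d : ℕ → ℝ) (h0 : d 0 = 0) (n : ℕ) :
    ∑ k ∈ Finset.range n, lam ^ k * (d (k + 1) - d k) =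
      (1 - lam) * ∑ k ∈ Finset.range n, lam ^ k * d (k + 1) + lam ^ n * d n := by
  induction n with
  | zero => simp [h0]
  | succ n ih => rw [Finset.sum_range_succ, ih, Finset.sum_range_succ]; ring

theorem jumpSum_lt {b : ℕ → ℕ} (hlam0 : 0 < lam) (hlam1 : lam < 1) (hmu : 0 < mu)
    (ha : IsStepSeq a) (hsa : Summable fun k => lam ^ k * mu ^ a k)
    (hb : IsStepSeq b) (hsb : Summable fun k => lam ^ k * mu ^ b k)
    (h0 : a 0 = b 0) (hle : ∀ k, a k ≤ b k) {j : ℕ} (hj : a (j + 1) < b (j + 1)) :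
    jumpSum lam mu a < jumpSum lam mu b := by
  -- With `g n = 1 + μ + ⋯ + μ^{n-1}`, each term becomes `λ^k (g(a(k+1)) - g(a(k)))`. Summation by
  -- parts then shows that the jump sum increases with `a`.
  set g : ℕ → ℝ := fun n => ∑ i ∈ Finset.range n, mu ^ i with hg
  have gm : StrictMono g := strictMono_nat_of_lt_succ fun n => by
    simp only [hg, Finset.sum_range_succ]
    have : 0 < mu ^ n := by positivity
    linarith
  have gs : ∀ c : ℕ → ℕ, IsStepSeq c → ∀ k,
      ((c (k + 1) : ℝ) - c k) * (lam ^ k * mu ^ c k) = lam ^ k * (g (c (k + 1)) - g (c k)) := by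
    intro c hc k
    rcases hc k with h | h <;> rw [h]
    · simp
    · simp only [hg, Finset.sum_range_succ]; push_cast; ring
  set d : ℕ → ℝ := fun k => g (b k) - g (a k) with hd
  have hd0 : d 0 = 0 := by simp [hd, h0]
  have hdn : ∀ k, 0 ≤ d k := fun k => sub_nonneg.2 (gm.monotone (hle k))
  have hdj : 0 < d (j + 1) := sub_pos.2 (gm hj)
  have hsum : HasSum (fun k => lam ^ k * (d (k + 1) - d k))
      (jumpSum lam mu b - jumpSum lam mu a) := by
    have := (summable_jump hlam0 hmu hb hsb).hasSum.sub (summable_jump hlam0 hmu ha hsa).hasSum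
    have e : (fun k => lam ^ k * (d (k + 1) - d k)) = fun k =>
        ((b (k + 1) : ℝ) - b k) * (lam ^ k * mu ^ b k) -
          ((a (k + 1) : ℝ) - a k) * (lam ^ k * mu ^ a k) := by
      funext k
      rw [gs b hb, gs a ha]
      simp only [hd]
      ring
    rw [e]
    exact this
  have hlim := hsum.tendsto_sum_nat
  have hpos : 0 < (1 - lam) * (lam ^ j * d (j + 1)) :=
    mul_pos (sub_pos.2 hlam1) (by positivity)
  have : (1 - lam) * (lam ^ j * d (j + 1)) ≤ jumpSum lam mu b - jumpSum lam mu a := by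
    refine ge_of_tendsto hlim (eventually_atTop.2 ⟨j + 1, fun n hn => ?_⟩)
    rw [sum_pow_mul_diff lam d hd0]
    have h1 : lam ^ j * d (j + 1) ≤ ∑ k ∈ Finset.range n, lam ^ k * d (k + 1) :=
      Finset.single_le_sum (f := fun k => lam ^ k * d (k + 1))
        (fun k _ => mul_nonneg (by positivity) (hdn _)) (Finset.mem_range.2 hn)
    have h2 : 0 ≤ lam ^ n * d n := mul_nonneg (by positivity) (hdn _)
    have := mul_le_mul_of_nonneg_left h1 (sub_pos.2 hlam1).le
    linarith
  linarith

end Series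

/-! ### The series of `phi` at the points `m/q` -/

theorem isStepSeq_div {p q : ℕ} (i : ℕ) (hq : 0 < q) (hpq : p < q) :
    IsStepSeq fun k => (k * p + i) / q := by
  intro k
  have h : (k + 1) * p + i = k * p + i + p := by ring
  simp only [h]
  have h1 : (k * p + i) / q ≤ (k * p + i + p) / q := Nat.div_le_div_right (by omega)
  have h2 : (k * p + i + p) / q ≤ (k * p + i) / q + 1 := by
    rw [← Nat.add_div_right _ hq]; exact Nat.div_le_div_right (by omega)
  omega

section Series

variable {lam mu : ℝ} {p q : ℕ}

theorem summable_weight_div (i : ℕ) (hlam0 : 0 < lam) (hlam1 : lam < 1) (hmu : 0 < mu)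
    (hrho1 : (p : ℝ) / q < rBound lam mu) :
    Summable fun k => lam ^ k * mu ^ ((k * p + i) / q) := by
  have hs : Summable fun k => max 1 mu ^ ((i : ℝ) / q) * ratio lam mu ((p : ℝ) / q) ^ k :=
    (summable_geometric_of_lt_one (ratio_pos _ _ hlam0).le
      (ratio_lt_one hlam0 hlam1 hrho1)).mul_left _
  refine Summable.of_nonneg_of_le (fun k => by positivity) (fun k => ?_) hs
  refine weight_le hlam0 hmu (Nat.cast_div_le.trans (le_of_eq ?_))
  push_cast
  ring

theorem floor_natCast_div_sub {m k : ℕ} (hm : m < q) :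
    ⌊(m : ℝ) / q - k * ((p : ℝ) / q)⌋ = -(((k * p + (q - 1 - m)) / q : ℕ) : ℤ) := by
  have hq : 0 < q := by omega
  have hq' : (0 : ℝ) < q := by exact_mod_cast hq
  set A := (k * p + (q - 1 - m)) / q with hA
  have h1 : q * A ≤ k * p + (q - 1 - m) := Nat.mul_div_le _ _
  have h2 : k * p + (q - 1 - m) < q * (A + 1) := by
    exact Nat.lt_mul_div_succ (k * p + (q - 1 - m)) hq
  have h3 : k * p ≤ q * A + m := by rw [mul_add] at h2; omega
  have h4 : q * A + m + 1 ≤ k * p + q := by omega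
  have e : (m : ℝ) / q - k * ((p : ℝ) / q) = (m - k * p) / q := by ring
  have h3' : (k : ℝ) * p ≤ q * A + m := by exact_mod_cast h3
  have h4' : (q : ℝ) * A + m + 1 ≤ k * p + q := by exact_mod_cast h4
  rw [e, Int.floor_eq_iff, le_div_iff₀ hq', div_lt_iff₀ hq']
  push_cast
  constructor <;> nlinarith

/-- The exponents in the series for `zeta_m`. -/
def expSeq (p q m : ℕ) (k : ℕ) : ℕ := (k * p + (q - 1 - m)) / q

theorem phi_natCast_div (delta : ℝ) {m : ℕ} (hm : m < q) :
    phi lam mu delta ((p : ℝ) / q) ((m : ℝ) / q) =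
      (1 - delta) / lam + ∑' k, lam ^ k * mu ^ expSeq p q m k *
        ((lam + delta - 1) / lam + ((expSeq p q m k : ℝ) - expSeq p q m (k + 1))) := by
  have h0 : ⌊(m : ℝ) / q⌋ = 0 := by
    have := floor_natCast_div_sub (p := p) (k := 0) hm
    rw [Nat.cast_zero, zero_mul, sub_zero] at this
    rw [this, Nat.div_eq_of_lt (by omega)]
    simp
  unfold phi
  rw [h0, Int.cast_zero, zero_add]
  congr 1
  refine tsum_congr fun k => ?_
  have hk : (k : ℝ) + 1 = ((k + 1 : ℕ) : ℝ) := by push_cast; ring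
  rw [hk, floor_natCast_div_sub hm, floor_natCast_div_sub hm]
  rw [zero_sub, neg_neg, zpow_natCast]
  simp only [expSeq]
  generalize (k * p + (q - 1 - m)) / q = x
  generalize ((k + 1) * p + (q - 1 - m)) / q = y
  push_cast
  ring

theorem one_sub_mul_phi (delta : ℝ) {m : ℕ} (hlam0 : 0 < lam) (hlam1 : lam < 1) (hmu : 0 < mu)
    (hpq : p < q) (hrho1 : (p : ℝ) / q < rBound lam mu) (hm : m < q) :
    (1 - lam) * phi lam mu delta ((p : ℝ) / q) ((m : ℝ) / q) =
      delta - (delta - mu * (lam + delta - 1)) * jumpSum lam mu (expSeq p q m) := by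
  rw [phi_natCast_div delta hm]
  refine one_sub_mul_series delta hlam0 hmu (isStepSeq_div _ (by omega) hpq) ?_
    (summable_weight_div _ hlam0 hlam1 hmu hrho1)
  unfold expSeq
  rw [zero_mul, zero_add, Nat.div_eq_of_lt (by omega)]

theorem exists_mul_mod_eq (hpq : Nat.Coprime p q) {m : ℕ} (hm : m < q) :
    ∃ j, ((j + 1) * p) % q = m := by
  have hq : 0 < q := by omega
  obtain ⟨b, hb⟩ := Nat.exists_mul_mod_eq_of_coprime m hpq hq.ne'
  -- Adding a full period `q` to `b` makes the index positive, so that it has the form `j + 1`.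
  refine ⟨b + (q - 1), ?_⟩
  have : (b + (q - 1) + 1) * p = p * b + q * p := by
    rw [add_assoc, Nat.sub_add_cancel hq]; ring
  rw [this, Nat.add_mul_mod_self_left, hb.2, Nat.mod_eq_of_lt hm]

/-- Raising `m` lowers the exponents, strictly at an index where `(j+1)p ≡ m+1` modulo `q`; such an
index exists by coprimality. The jump sum enters `phi` with a negative coefficient. -/
theorem phi_lt_phi {delta : ℝ} {m : ℕ} (hlam0 : 0 < lam) (hlam1 : lam < 1) (hmu : 0 < mu)
    (hgap : mu * (lam + delta - 1) < delta)
    (hpq : p < q) (hco : Nat.Coprime p q) (hrho1 : (p : ℝ) / q < rBound lam mu) (hm : m + 1 < q) :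
    phi lam mu delta ((p : ℝ) / q) ((m : ℝ) / q) <
      phi lam mu delta ((p : ℝ) / q) (((m + 1 : ℕ) : ℝ) / q) := by
  have h1 := one_sub_mul_phi delta hlam0 hlam1 hmu hpq hrho1 (m := m) (by omega)
  have h2 := one_sub_mul_phi delta hlam0 hlam1 hmu hpq hrho1 hm
  obtain ⟨j, hj⟩ := exists_mul_mod_eq hco hm
  have h3 : jumpSum lam mu (expSeq p q (m + 1)) < jumpSum lam mu (expSeq p q m) := by
    refine jumpSum_lt (j := j) hlam0 hlam1 hmu (isStepSeq_div _ (by omega) hpq)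
      (summable_weight_div _ hlam0 hlam1 hmu hrho1) (isStepSeq_div _ (by omega) hpq)
      (summable_weight_div _ hlam0 hlam1 hmu hrho1) ?_
      (fun k => Nat.div_le_div_right (by omega)) ?_
    · unfold expSeq
      rw [Nat.div_eq_of_lt (by omega), Nat.div_eq_of_lt (by omega)]
    · have h4 := Nat.div_add_mod ((j + 1) * p) q
      rw [hj] at h4
      set B := (j + 1) * p / q
      have h5 : expSeq p q (m + 1) (j + 1) = B := by
        unfold expSeq
        rw [show (j + 1) * p + (q - 1 - (m + 1)) = (q - 1) + q * B by omega,
          Nat.add_mul_div_left _ _ (by omega), Nat.div_eq_of_lt (by omega), zero_add]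
      have h6 : expSeq p q m (j + 1) = B + 1 := by
        unfold expSeq
        rw [show (j + 1) * p + (q - 1 - m) = q + q * B by omega,
          Nat.add_mul_div_left _ _ (by omega), Nat.div_self (by omega), add_comm]
      omega
  have h7 := mul_lt_mul_of_pos_left h3 (sub_pos.2 hgap)
  have h8 : (1 - lam) * phi lam mu delta ((p : ℝ) / q) ((m : ℝ) / q) <
      (1 - lam) * phi lam mu delta ((p : ℝ) / q) (((m + 1 : ℕ) : ℝ) / q) := by linarith
  exact lt_of_mul_lt_mul_left h8 (by linarith)

end Series

/-! ### The rotation relation and the position of the extreme orbit points -/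

section Series

variable {lam mu : ℝ} {p q : ℕ}

theorem jumpSum_add_one (lam mu : ℝ) (a : ℕ → ℕ) :
    jumpSum lam mu (fun k => a k + 1) = mu * jumpSum lam mu a := by
  unfold jumpSum
  rw [← tsum_mul_left]
  refine tsum_congr fun k => ?_
  push_cast
  ring

theorem expSeq_zero {m : ℕ} (hm : m < q) : expSeq p q m 0 = 0 := by
  unfold expSeq
  rw [zero_mul, zero_add, Nat.div_eq_of_lt (by omega)]

/-- The exponents for `m + p`, shifted by one index, are those for `m`, and the first increment is
zero; so `J_{m+p} = λ J_m`. -/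
theorem phi_add_of_lt {delta : ℝ} {m : ℕ} (hlam0 : 0 < lam) (hlam1 : lam < 1) (hmu : 0 < mu)
    (hpq : p < q) (hrho1 : (p : ℝ) / q < rBound lam mu) (hm : m + p < q) :
    phi lam mu delta ((p : ℝ) / q) (((m + p : ℕ) : ℝ) / q) =
      lam * phi lam mu delta ((p : ℝ) / q) ((m : ℝ) / q) + delta := by
  have h1 := one_sub_mul_phi delta hlam0 hlam1 hmu hpq hrho1 (m := m) (by omega)
  have h2 := one_sub_mul_phi delta hlam0 hlam1 hmu hpq hrho1 hm
  have hs : (fun k => expSeq p q (m + p) (k + 1)) = expSeq p q m := by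
    funext k
    have : (k + 1) * p = k * p + p := by ring
    exact congrArg (· / q) (by omega)
  have h3 := jumpSum_eq_add hlam0 hmu
    (isStepSeq_div (p := p) (q - 1 - (m + p)) (by omega) hpq)
    (summable_weight_div _ hlam0 hlam1 hmu hrho1)
  change jumpSum lam mu (expSeq p q (m + p)) = ((expSeq p q (m + p) (0 + 1) : ℝ) -
    expSeq p q (m + p) 0) * mu ^ expSeq p q (m + p) 0 +
      lam * jumpSum lam mu (fun k => expSeq p q (m + p) (k + 1)) at h3
  rw [hs, congrFun hs 0, expSeq_zero hm, expSeq_zero (by omega : m < q)] at h3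
  rw [h3] at h2
  have h4 : (1 - lam) ≠ 0 := by linarith
  refine mul_left_cancel₀ h4 ?_
  simp only [Nat.cast_zero, sub_zero, zero_mul, zero_add] at h2
  linear_combination h2 - lam * h1

/-- The shifted exponents are now those for `m` plus one, and the first increment is one; so
`J_{m+p-q} = 1 + λμ J_m`. -/
theorem phi_add_of_le {delta : ℝ} {m : ℕ} (hlam0 : 0 < lam) (hlam1 : lam < 1) (hmu : 0 < mu)
    (hpq : p < q) (hrho1 : (p : ℝ) / q < rBound lam mu) (hm : m < q) (hmp : q ≤ m + p) :
    phi lam mu delta ((p : ℝ) / q) (((m + p - q : ℕ) : ℝ) / q) =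
      mu * (lam * phi lam mu delta ((p : ℝ) / q) ((m : ℝ) / q) + delta - 1) := by
  have hn : m + p - q < q := by omega
  have h1 := one_sub_mul_phi delta hlam0 hlam1 hmu hpq hrho1 (m := m) (by omega)
  have h2 := one_sub_mul_phi delta hlam0 hlam1 hmu hpq hrho1 hn
  have hs : (fun k => expSeq p q (m + p - q) (k + 1)) = fun k => expSeq p q m k + 1 := by
    funext k
    unfold expSeq
    have : (k + 1) * p = k * p + p := by ring
    rw [← Nat.add_div_right _ (by omega : 0 < q)]
    exact congrArg (· / q) (by omega)
  have h3 := jumpSum_eq_add hlam0 hmu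
    (isStepSeq_div (p := p) (q - 1 - (m + p - q)) (by omega) hpq)
    (summable_weight_div _ hlam0 hlam1 hmu hrho1)
  change jumpSum lam mu (expSeq p q (m + p - q)) = ((expSeq p q (m + p - q) (0 + 1) : ℝ) -
    expSeq p q (m + p - q) 0) * mu ^ expSeq p q (m + p - q) 0 +
      lam * jumpSum lam mu (fun k => expSeq p q (m + p - q) (k + 1)) at h3
  rw [hs, congrFun hs 0, expSeq_zero hn, expSeq_zero hm, jumpSum_add_one] at h3
  rw [h3] at h2
  have h4 : (1 - lam) ≠ 0 := by linarith
  refine mul_left_cancel₀ h4 ?_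
  simp only [Nat.cast_zero, sub_zero, zero_add, Nat.cast_one, one_mul, pow_zero] at h2
  linear_combination h2 - lam * mu * h1

theorem sigmaSeries_eq_of_floor {rho : ℝ} {b : ℕ → ℕ}
    (hb : ∀ k : ℕ, ⌊((k : ℝ) + 1) * rho⌋ = b k) :
    sigmaSeries lam mu rho = lam * jumpSum lam mu b := by
  unfold sigmaSeries jumpSum
  rw [← tsum_mul_left]
  refine tsum_congr fun k => ?_
  have h2 : (k : ℝ) + 2 = ((k + 1 : ℕ) : ℝ) + 1 := by push_cast; ring
  rw [h2, hb, hb, zpow_natCast]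
  push_cast
  ring

theorem norm_sigma_term_le {rho t : ℝ} (hlam0 : 0 < lam) (hmu : 0 < mu) (ht0 : 0 < t)
    (ht : t ≤ rho) (ht1 : t ≤ 1) (k : ℕ) :
    ‖((⌊((k : ℝ) + 2) * t⌋ - ⌊((k : ℝ) + 1) * t⌋ : ℤ) : ℝ) * lam ^ (k + 1) *
      mu ^ ⌊((k : ℝ) + 1) * t⌋‖ ≤ ratio lam mu rho ^ (k + 1) := by
  have h0 : 0 ≤ ((k : ℝ) + 1) * t := by positivity
  obtain ⟨n, hn⟩ := Int.eq_ofNat_of_zero_le (Int.floor_nonneg.2 h0)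
  have hle := Int.floor_le (((k : ℝ) + 1) * t)
  have e : ((k : ℝ) + 2) * t = ((k : ℝ) + 1) * t + t := by ring
  have h1 : ⌊((k : ℝ) + 1) * t⌋ ≤ ⌊((k : ℝ) + 2) * t⌋ := Int.floor_le_floor (by linarith)
  have h2 : ⌊((k : ℝ) + 2) * t⌋ ≤ ⌊((k : ℝ) + 1) * t⌋ + 1 := by
    rw [← Int.floor_add_one]
    exact Int.floor_le_floor (by linarith)
  rw [hn] at h1 h2 hle ⊢
  have hw := weight_le (C := 0) (rho := rho) (k := k + 1) (n := n) hlam0 hmu (by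
    push_cast at hle ⊢
    have : ((k : ℝ) + 1) * t ≤ ((k : ℝ) + 1) * rho := mul_le_mul_of_nonneg_left ht (by positivity)
    linarith)
  rw [Real.rpow_zero, one_mul] at hw
  refine le_trans ?_ hw
  have hpos : 0 < lam ^ (k + 1) * mu ^ n := by positivity
  rw [zpow_natCast, mul_assoc, norm_mul, Real.norm_of_nonneg hpos.le]
  refine mul_le_of_le_one_left hpos.le ?_
  rw [Real.norm_eq_abs, ← Int.cast_abs, ← Int.cast_one, Int.cast_le, abs_le]
  omega

/-- As `t` increases to `ρ`, `⌊(k+1)t⌋` is eventually `⌈(k+1)ρ⌉ - 1`. Powers of `ratio` dominate the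
terms, so the limit may be taken termwise. -/
theorem tendsto_sigmaSeries_left {rho : ℝ} {b : ℕ → ℕ} (hlam0 : 0 < lam) (hlam1 : lam < 1)
    (hmu : 0 < mu) (hrho0 : 0 < rho) (hrho1 : rho < rBound lam mu)
    (hb : ∀ k : ℕ, ⌈((k : ℝ) + 1) * rho⌉ - 1 = b k) :
    Tendsto (fun t => sigmaSeries lam mu t) (𝓝[<] rho) (𝓝 (lam * jumpSum lam mu b)) := by
  have hr1 := lt_one_of_lt_rBound hlam0 hlam1 hrho1
  have hlim : lam * jumpSum lam mu b = ∑' k : ℕ,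
      (((b (k + 1) : ℤ) - (b k : ℤ) : ℤ) : ℝ) * lam ^ (k + 1) * mu ^ (b k : ℤ) := by
    unfold jumpSum
    rw [← tsum_mul_left]
    refine tsum_congr fun k => ?_
    rw [zpow_natCast]
    push_cast
    ring
  have hfl : ∀ k : ℕ, ∀ᶠ t in 𝓝[<] rho, ⌊((k : ℝ) + 1) * t⌋ = b k := by
    intro k
    have hk : (0 : ℝ) < (k : ℝ) + 1 := by positivity
    have h1 : Tendsto (fun t => ((k : ℝ) + 1) * t) (𝓝[<] rho) (𝓝[<] (((k : ℝ) + 1) * rho)) := by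
      refine tendsto_nhdsWithin_of_tendsto_nhds_of_eventually_within _ ?_ ?_
      · exact ((continuous_const.mul continuous_id).tendsto rho).mono_left nhdsWithin_le_nhds
      · filter_upwards [self_mem_nhdsWithin] with t ht
        exact mul_lt_mul_of_pos_left ht hk
    have h2 := (tendsto_floor_left_pure_ceil_sub_one (((k : ℝ) + 1) * rho)).comp h1
    rw [hb k] at h2
    exact tendsto_pure.1 h2
  rw [hlim]
  unfold sigmaSeries
  refine tendsto_tsum_of_dominated_convergence
    (bound := fun k => ratio lam mu rho ^ (k + 1)) ?_ (fun k => ?_) ?_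
  · exact (summable_nat_add_iff 1).2 (summable_geometric_of_lt_one (ratio_pos _ _ hlam0).le
      (ratio_lt_one hlam0 hlam1 hrho1))
  · refine tendsto_const_nhds.congr' ?_
    filter_upwards [hfl k, hfl (k + 1)] with t h1 h2
    have e : (k : ℝ) + 2 = ((k + 1 : ℕ) : ℝ) + 1 := by push_cast; ring
    rw [e, h1, h2]
  · filter_upwards [Ioo_mem_nhdsLT hrho0] with t ht k
    exact norm_sigma_term_le hlam0 hmu ht.1 ht.2.le (ht.2.le.trans hr1.le) k

/-- Here `J_{q-1} = σ(p/q)`, and the claim is `δ < δ(λ,μ,p/q)` with the denominator cleared. -/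
theorem phi_last_lt_one {delta : ℝ} (hlam0 : 0 < lam) (hlam1 : lam < 1) (hmu : 0 < mu)
    (hpq : p < q) (hrho1 : (p : ℝ) / q < rBound lam mu)
    (hright : delta < deltaFun lam mu ((p : ℝ) / q)) :
    phi lam mu delta ((p : ℝ) / q) (((q - 1 : ℕ) : ℝ) / q) < 1 := by
  have hq : 0 < q := by omega
  have h1 := one_sub_mul_phi delta hlam0 hlam1 hmu hpq hrho1 (m := q - 1) (by omega)
  have hstep : IsStepSeq (expSeq p q (q - 1)) := isStepSeq_div _ hq hpq
  have hsum : Summable fun k => lam ^ k * mu ^ expSeq p q (q - 1) k :=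
    summable_weight_div _ hlam0 hlam1 hmu hrho1
  have hshift : (fun k => expSeq p q (q - 1) (k + 1)) = fun k => (k * p + p) / q := by
    funext k
    exact congrArg (· / q) (by rw [Nat.sub_self]; ring)
  have h3 := jumpSum_eq_add hlam0 hmu hstep hsum
  have h10 : expSeq p q (q - 1) 1 = 0 := by
    have := congrFun hshift 0
    simp only [zero_add, zero_mul] at this
    rw [this, Nat.div_eq_of_lt hpq]
  rw [expSeq_zero (by omega), h10, hshift] at h3
  simp only [sub_self, zero_mul, zero_add] at h3
  have hsig : sigmaSeries lam mu ((p : ℝ) / q) = lam * jumpSum lam mu fun k => (k * p + p) / q := by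
    refine sigmaSeries_eq_of_floor fun k => ?_
    have e : ((k : ℝ) + 1) * ((p : ℝ) / q) = ((k * p + p : ℕ) : ℝ) / (q : ℕ) := by
      push_cast; ring
    rw [e, Int.floor_div_natCast, Int.floor_natCast, Int.natCast_div]
  have hD := one_add_mul_jumpSum_pos hlam0 hlam1 hmu (isStepSeq_div (p := p) p hq hpq)
    (by rw [zero_mul, zero_add, Nat.div_eq_of_lt hpq])
    (summable_weight_div _ hlam0 hlam1 hmu hrho1)
  unfold deltaFun at hright
  rw [hsig, lt_div_iff₀ hD] at hright
  rw [h3] at h1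
  have : (1 - lam) * phi lam mu delta ((p : ℝ) / q) (((q - 1 : ℕ) : ℝ) / q) < (1 - lam) * 1 := by
    rw [h1]; linarith
  exact lt_of_mul_lt_mul_left this (by linarith)

/-- Here `J_0 = 1 + μσ⁻`, where `σ⁻` is the left limit of `σ` at `p/q`, and the claim is the lower
bound on `δ` with the denominator cleared. -/
theorem phi_zero_nonneg {delta : ℝ} (hlam0 : 0 < lam) (hlam1 : lam < 1) (hmu : 0 < mu)
    (hp : 0 < p) (hpq : p < q) (hrho1 : (p : ℝ) / q < rBound lam mu)
    (hleft : deltaFunLeft lam mu ((p : ℝ) / q) ≤ delta) :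
    0 ≤ phi lam mu delta ((p : ℝ) / q) (((0 : ℕ) : ℝ) / q) := by
  have hq : 0 < q := by omega
  have h1 := one_sub_mul_phi delta hlam0 hlam1 hmu hpq hrho1 (m := 0) (by omega)
  have hstep : IsStepSeq (expSeq p q 0) := isStepSeq_div _ hq hpq
  have hsum : Summable fun k => lam ^ k * mu ^ expSeq p q 0 k :=
    summable_weight_div _ hlam0 hlam1 hmu hrho1
  set b : ℕ → ℕ := fun k => (k * p + (p - 1)) / q with hb
  have hbs : IsStepSeq b := isStepSeq_div _ hq hpq
  have hb0 : b 0 = 0 := by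
    simp only [hb]
    rw [zero_mul, zero_add, Nat.div_eq_of_lt (by omega)]
  have hshift : (fun k => expSeq p q 0 (k + 1)) = fun k => b k + 1 := by
    funext k
    simp only [hb]
    rw [← Nat.add_div_right _ hq]
    have : (k + 1) * p = k * p + p := by ring
    exact congrArg (· / q) (by omega)
  have h3 := jumpSum_eq_add hlam0 hmu hstep hsum
  rw [expSeq_zero (by omega), hshift, jumpSum_add_one, show expSeq p q 0 1 = b 0 + 1 from
    congrFun hshift 0, hb0] at h3
  simp only [zero_add, Nat.cast_one, Nat.cast_zero, sub_zero, pow_zero, one_mul] at h3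
  have hq' : (0 : ℝ) < q := by exact_mod_cast hq
  have hlim := tendsto_sigmaSeries_left (b := b) (rho := (p : ℝ) / q) hlam0 hlam1 hmu
    (by positivity) hrho1 (fun k => by
      have e1 := Nat.div_add_mod (k * p + (p - 1)) q
      have e2 := Nat.mod_lt (k * p + (p - 1)) hq
      change q * b k + _ = _ at e1
      have e3 : q * b k + 1 ≤ k * p + p := by omega
      have e4 : k * p + p ≤ q * b k + q := by omega
      have e3' : (q : ℝ) * b k + 1 ≤ k * p + p := by exact_mod_cast e3
      have e4' : (k : ℝ) * p + p ≤ q * b k + q := by exact_mod_cast e4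
      rw [sub_eq_iff_eq_add, Int.ceil_eq_iff, ← mul_div_assoc, div_le_iff₀ hq', lt_div_iff₀ hq']
      push_cast
      constructor <;> nlinarith)
  have hD := one_add_mul_jumpSum_pos hlam0 hlam1 hmu hbs hb0
    (summable_weight_div _ hlam0 hlam1 hmu hrho1)
  have hlim2 : Tendsto (fun t => deltaFun lam mu t) (𝓝[<] ((p : ℝ) / q))
      (𝓝 ((1 - lam) * (1 + mu * (lam * jumpSum lam mu b)) /
        (1 + (mu - 1) * (lam * jumpSum lam mu b)))) := by
    unfold deltaFun
    exact (((hlim.const_mul mu).const_add 1).const_mul (1 - lam)).div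
      ((hlim.const_mul (mu - 1)).const_add 1) hD.ne'
  rw [deltaFunLeft, leftLim_eq_of_tendsto hlim2, div_le_iff₀ hD] at hleft
  rw [h3] at h1
  have h5 : (1 - lam) * phi lam mu delta ((p : ℝ) / q) (((0 : ℕ) : ℝ) / q) =
      mu * (delta * (1 + (mu - 1) * (lam * jumpSum lam mu b)) -
        (1 - lam) * (1 + mu * (lam * jumpSum lam mu b))) := by
    rw [h1]; ring
  have h6 : 0 ≤ (1 - lam) * phi lam mu delta ((p : ℝ) / q) (((0 : ℕ) : ℝ) / q) := by
    rw [h5]; exact mul_nonneg hmu.le (by linarith)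
  exact nonneg_of_mul_nonneg_right h6 (by linarith)

end Series

/-! ### The two affine branches -/

section Branches

variable {lam mu delta : ℝ}

theorem lt_eta_iff (hlam0 : 0 < lam) {x : ℝ} : x < eta lam delta ↔ lam * x + delta < 1 := by
  unfold eta
  rw [lt_div_iff₀ hlam0]
  constructor <;> intro h <;> linarith

theorem affMap_left (hlam0 : 0 < lam) {x : ℝ} (h : lam * x + delta < 1) :
    affMap lam mu delta x = lam * x + delta := if_pos ((lt_eta_iff hlam0).2 h)

theorem affMap_right (hlam0 : 0 < lam) {x : ℝ} (h : 1 ≤ lam * x + delta) :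
    affMap lam mu delta x = mu * (lam * x + delta - 1) :=
  if_neg fun h' => (not_lt.2 h) ((lt_eta_iff hlam0).1 h')

theorem image_affMap_left (hlam0 : 0 < lam) {a b : ℝ} (hb : lam * b + delta ≤ 1) :
    affMap lam mu delta '' Ico a b = Ico (lam * a + delta) (lam * b + delta) := by
  ext y
  constructor
  · rintro ⟨x, ⟨h1, h2⟩, rfl⟩
    have h3 := mul_le_mul_of_nonneg_left h1 hlam0.le
    have h4 := mul_lt_mul_of_pos_left h2 hlam0
    rw [affMap_left hlam0 (by linarith)]
    exact ⟨by linarith, by linarith⟩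
  · rintro ⟨h1, h2⟩
    have e : lam * ((y - delta) / lam) = y - delta := mul_div_cancel₀ _ hlam0.ne'
    refine ⟨(y - delta) / lam, ⟨?_, ?_⟩, ?_⟩
    · rw [le_div_iff₀ hlam0]; linarith
    · rw [div_lt_iff₀ hlam0]; linarith
    · rw [affMap_left hlam0 (by linarith), e]; ring

theorem image_affMap_right (hlam0 : 0 < lam) (hmu : 0 < mu) {a b : ℝ}
    (ha : 1 ≤ lam * a + delta) :
    affMap lam mu delta '' Ico a b =
      Ico (mu * (lam * a + delta - 1)) (mu * (lam * b + delta - 1)) := by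
  ext y
  constructor
  · rintro ⟨x, ⟨h1, h2⟩, rfl⟩
    have h3 := mul_le_mul_of_nonneg_left h1 hlam0.le
    have h4 := mul_lt_mul_of_pos_left h2 hlam0
    rw [affMap_right hlam0 (by linarith)]
    exact ⟨mul_le_mul_of_nonneg_left (by linarith) hmu.le,
      mul_lt_mul_of_pos_left (by linarith) hmu⟩
  · rintro ⟨h1, h2⟩
    have e : lam * ((y / mu + 1 - delta) / lam) = y / mu + 1 - delta :=
      mul_div_cancel₀ _ hlam0.ne'
    have h1' := (le_div_iff₀' hmu).2 h1
    have h2' := (div_lt_iff₀' hmu).2 h2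
    refine ⟨(y / mu + 1 - delta) / lam, ⟨?_, ?_⟩, ?_⟩
    · rw [le_div_iff₀ hlam0]; linarith
    · rw [div_lt_iff₀ hlam0]; linarith
    · rw [affMap_right hlam0 (by linarith), e]; field_simp; ring

end Branches

/-- A periodic orbit `Z 0 < ⋯ < Z (q - 1)` in `[0,1)` on which the map with parameters
`lam, mu, delta` acts as the rotation `N ↦ N + p`. -/
structure IsRotationOrbit (lam mu delta : ℝ) (p q : ℕ) (Z : ℕ → ℝ) : Prop where
  lam_pos : 0 < lam
  lam_lt_one : lam < 1
  mu_pos : 0 < mu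
  lt_delta : 1 - lam < delta
  delta_lt : delta < 1
  gap : mu * (lam + delta - 1) < delta
  p_pos : 0 < p
  p_lt : p < q
  coprime : Nat.Coprime p q
  slope_lt : lam ^ q * mu ^ p < 1
  mod_eq : ∀ N, Z (N % q) = Z N
  lt_of_lt : ∀ m n, m < n → n < q → Z m < Z n
  zero_nonneg : 0 ≤ Z 0
  last_lt : Z (q - 1) < 1
  left : ∀ N, N % q < q - p → Z (N + p) = lam * Z N + delta
  right : ∀ N, q - p ≤ N % q → Z (N + p) = mu * (lam * Z N + delta - 1)

/-! ### Comparison with a rotation orbit -/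

namespace IsRotationOrbit

variable {lam mu delta : ℝ} {p q : ℕ} {Z : ℕ → ℝ}

theorem q_pos (h : IsRotationOrbit lam mu delta p q Z) : 0 < q := h.p_pos.trans h.p_lt

theorem le_of_le (h : IsRotationOrbit lam mu delta p q Z) {m n : ℕ} (hmn : m ≤ n) (hn : n < q) :
    Z m ≤ Z n := by
  rcases hmn.eq_or_lt with rfl | hlt
  · exact le_rfl
  · exact (h.lt_of_lt m n hlt hn).le

theorem mem_Ico (h : IsRotationOrbit lam mu delta p q Z) (N : ℕ) : Z N ∈ Ico (0 : ℝ) 1 := by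
  have hm := Nat.mod_lt N h.q_pos
  rw [← h.mod_eq]
  exact ⟨h.zero_nonneg.trans (h.le_of_le (Nat.zero_le _) hm),
    (h.le_of_le (by omega) (by omega)).trans_lt h.last_lt⟩

theorem eq_of_mod (h : IsRotationOrbit lam mu delta p q Z) {M N : ℕ} (hMN : M % q = N % q) :
    Z M = Z N := by rw [← h.mod_eq M, hMN, h.mod_eq]

theorem image_lt_one (h : IsRotationOrbit lam mu delta p q Z) {N : ℕ} (hN : N % q < q - p) :
    lam * Z N + delta < 1 := by rw [← h.left N hN]; exact (h.mem_Ico _).2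

theorem one_le_image (h : IsRotationOrbit lam mu delta p q Z) {N : ℕ} (hN : q - p ≤ N % q) :
    1 ≤ lam * Z N + delta := by
  have h1 := (h.mem_Ico (N + p)).1
  rw [h.right N hN] at h1
  linarith [nonneg_of_mul_nonneg_right h1 h.mu_pos]

theorem affMap_orbit (h : IsRotationOrbit lam mu delta p q Z) (N : ℕ) :
    affMap lam mu delta (Z N) = Z (N + p) := by
  rcases lt_or_ge (N % q) (q - p) with hN | hN
  · rw [h.left N hN, affMap_left h.lam_pos (h.image_lt_one hN)]
  · rw [h.right N hN, affMap_right h.lam_pos (h.one_le_image hN)]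

theorem iterate_orbit (h : IsRotationOrbit lam mu delta p q Z) (N l : ℕ) :
    (affMap lam mu delta)^[l] (Z N) = Z (N + l * p) := by
  induction l with
  | zero => simp
  | succ l ih => rw [Function.iterate_succ_apply', ih, h.affMap_orbit]; congr 1; ring

theorem div_add_of_lt (h : IsRotationOrbit lam mu delta p q Z) {N : ℕ} (hN : N % q < q - p) :
    (N + p) / q = N / q := by
  rw [Nat.add_div h.q_pos, Nat.div_eq_of_lt h.p_lt, Nat.mod_eq_of_lt h.p_lt, if_neg (by omega),
    add_zero, add_zero]

theorem div_add_of_le (h : IsRotationOrbit lam mu delta p q Z) {N : ℕ} (hN : q - p ≤ N % q) :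
    (N + p) / q = N / q + 1 := by
  have := h.p_lt
  rw [Nat.add_div h.q_pos, Nat.div_eq_of_lt h.p_lt, Nat.mod_eq_of_lt h.p_lt, if_pos (by omega)]

theorem iterate_eq_of_same_side (h : IsRotationOrbit lam mu delta p q Z) {N : ℕ} (hN : N < q)
    {x : ℝ} {l : ℕ} (hs : ∀ i < l,
      (lam * (affMap lam mu delta)^[i] x + delta < 1 ↔ (N + i * p) % q < q - p)) :
    (affMap lam mu delta)^[l] x =
      Z (N + l * p) + lam ^ l * mu ^ ((N + l * p) / q) * (x - Z N) := by
  induction l with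
  | zero => simp [Nat.div_eq_of_lt hN]
  | succ l ih =>
    have ih := ih fun i hi => hs i (hi.trans l.lt_succ_self)
    have hl := hs l l.lt_succ_self
    have e : N + (l + 1) * p = N + l * p + p := by ring
    rw [Function.iterate_succ_apply', e]
    rcases lt_or_ge ((N + l * p) % q) (q - p) with hc | hc
    · rw [affMap_left h.lam_pos (hl.2 hc), h.left _ hc, h.div_add_of_lt hc, ih]
      ring
    · rw [affMap_right h.lam_pos (not_lt.1 fun h' => (not_lt.2 hc) (hl.1 h')), h.right _ hc,
        h.div_add_of_le hc, ih]
      ring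

theorem mul_mod_eq_zero_iff (h : IsRotationOrbit lam mu delta p q Z) (l : ℕ) :
    l * p % q = 0 ↔ q ∣ l := by
  rw [← Nat.dvd_iff_mod_eq_zero]
  exact ⟨fun hd => h.coprime.symm.dvd_of_dvd_mul_right hd, fun hd => hd.mul_right p⟩

theorem mul_mod_eq_sub_iff (h : IsRotationOrbit lam mu delta p q Z) (l : ℕ) :
    l * p % q = q - p ↔ q ∣ l + 1 := by
  rw [← h.mul_mod_eq_zero_iff, add_mul, one_mul]
  have h1 := h.p_lt
  have h2 := h.p_pos
  have h3 := Nat.mod_lt (l * p) h.q_pos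
  rw [Nat.add_mod, Nat.mod_eq_of_lt h.p_lt]
  constructor
  · intro hh
    rw [hh, Nat.sub_add_cancel h1.le, Nat.mod_self]
  · intro hh
    rcases lt_or_ge (l * p % q + p) q with hc | hc
    · rw [Nat.mod_eq_of_lt hc] at hh; omega
    · rw [Nat.mod_eq_sub_mod hc, Nat.mod_eq_of_lt (by omega)] at hh; omega

theorem pred_mod_of_dvd (h : IsRotationOrbit lam mu delta p q Z) {l : ℕ} (hl : q ∣ l) :
    (q - 1 + l * p) % q = q - 1 := by
  have := h.q_pos
  rw [Nat.add_mod, (h.mul_mod_eq_zero_iff l).2 hl, Nat.mod_eq_of_lt (by omega : q - 1 < q),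
    add_zero, Nat.mod_eq_of_lt (by omega)]

theorem pred_mod_of_not_dvd (h : IsRotationOrbit lam mu delta p q Z) {l : ℕ} (hl : ¬ q ∣ l) :
    (q - 1 + l * p) % q + 1 = l * p % q := by
  have h0 := h.q_pos
  have h1 : l * p % q ≠ 0 := fun h' => hl ((h.mul_mod_eq_zero_iff l).1 h')
  have h3 := Nat.mod_lt (l * p) h.q_pos
  rw [Nat.add_mod, Nat.mod_eq_of_lt (by omega : q - 1 < q), Nat.mod_eq_sub_mod (by omega),
    Nat.mod_eq_of_lt (by omega)]
  omega

/-- The residues of `lp - 1` and `lp` are neighbours. They are separated only by the wrap-around,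
`lp ≡ 0`, or by the discontinuity, `lp ≡ q - p`. -/
theorem pred_mod_lt_iff (h : IsRotationOrbit lam mu delta p q Z) {l : ℕ} (hl : ¬ q ∣ l)
    (hl1 : ¬ q ∣ l + 1) : (q - 1 + l * p) % q < q - p ↔ l * p % q < q - p := by
  have h1 := h.pred_mod_of_not_dvd hl
  have h2 : l * p % q ≠ q - p := fun h' => hl1 ((h.mul_mod_eq_sub_iff l).1 h')
  omega

end IsRotationOrbit

/-- The left limit at `1` of the `l`-th iterate, in terms of the orbit `Z`. -/
noncomputable def leftEnd (lam mu : ℝ) (p q : ℕ) (Z : ℕ → ℝ) (l : ℕ) : ℝ :=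
  Z (q - 1 + l * p) + lam ^ l * mu ^ ((q - 1 + l * p) / q) * (1 - Z (q - 1))

/-- The image of `0` under the `l`-th iterate, in terms of the orbit `Z`. -/
noncomputable def rightEnd (lam mu : ℝ) (p q : ℕ) (Z : ℕ → ℝ) (l : ℕ) : ℝ :=
  Z (0 + l * p) + lam ^ l * mu ^ ((0 + l * p) / q) * (0 - Z 0)

/-! ### Ends of the holes, and itineraries of points near `1` and `0` -/

namespace IsRotationOrbit

variable {lam mu delta : ℝ} {p q : ℕ} {Z : ℕ → ℝ}

local notation "u" => leftEnd lam mu p q Z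
local notation "v" => rightEnd lam mu p q Z
local notation "f" => affMap lam mu delta

theorem leftEnd_succ_left (h : IsRotationOrbit lam mu delta p q Z) {l : ℕ}
    (hl : (q - 1 + l * p) % q < q - p) : u (l + 1) = lam * u l + delta := by
  have e : q - 1 + (l + 1) * p = q - 1 + l * p + p := by ring
  unfold leftEnd
  rw [e, h.left _ hl, h.div_add_of_lt hl]
  ring

theorem leftEnd_succ_right (h : IsRotationOrbit lam mu delta p q Z) {l : ℕ}
    (hl : q - p ≤ (q - 1 + l * p) % q) : u (l + 1) = mu * (lam * u l + delta - 1) := by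
  have e : q - 1 + (l + 1) * p = q - 1 + l * p + p := by ring
  unfold leftEnd
  rw [e, h.right _ hl, h.div_add_of_le hl]
  ring

theorem rightEnd_succ_left (h : IsRotationOrbit lam mu delta p q Z) {l : ℕ}
    (hl : l * p % q < q - p) : v (l + 1) = lam * v l + delta := by
  rw [← zero_add (l * p)] at hl
  have e : 0 + (l + 1) * p = 0 + l * p + p := by ring
  unfold rightEnd
  rw [e, h.left _ hl, h.div_add_of_lt hl]
  ring

theorem rightEnd_succ_right (h : IsRotationOrbit lam mu delta p q Z) {l : ℕ}
    (hl : q - p ≤ l * p % q) : v (l + 1) = mu * (lam * v l + delta - 1) := by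
  rw [← zero_add (l * p)] at hl
  have e : 0 + (l + 1) * p = 0 + l * p + p := by ring
  unfold rightEnd
  rw [e, h.right _ hl, h.div_add_of_le hl]
  ring

theorem leftEnd_zero (h : IsRotationOrbit lam mu delta p q Z) : u 0 = 1 := by
  have := h.q_pos
  simp [leftEnd, Nat.div_eq_of_lt (by omega : q - 1 < q)]

theorem rightEnd_zero : v 0 = 0 := by simp [rightEnd]

theorem leftEnd_of_dvd (h : IsRotationOrbit lam mu delta p q Z) (k : ℕ) :
    u (q * k) = Z (q - 1) + (lam ^ q * mu ^ p) ^ k * (1 - Z (q - 1)) := by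
  have := h.q_pos
  unfold leftEnd
  rw [mul_assoc, Nat.add_mul_div_left _ _ this, Nat.div_eq_of_lt (by omega), mul_comm k p,
    zero_add, mul_pow, ← pow_mul, ← pow_mul,
    h.eq_of_mod (show (q - 1 + q * (p * k)) % q = (q - 1) % q by rw [Nat.add_mul_mod_self_left])]

theorem rightEnd_of_dvd (h : IsRotationOrbit lam mu delta p q Z) (k : ℕ) :
    v (q * k) = Z 0 - (lam ^ q * mu ^ p) ^ k * Z 0 := by
  have := h.q_pos
  unfold rightEnd
  rw [mul_assoc, Nat.add_mul_div_left _ _ this, Nat.zero_div, mul_comm k p,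
    zero_add, zero_add, mul_pow, ← pow_mul, ← pow_mul,
    h.eq_of_mod (show (q * (p * k)) % q = 0 % q by rw [Nat.mul_mod_right, Nat.zero_mod])]
  ring

theorem slope_pos (h : IsRotationOrbit lam mu delta p q Z) : 0 < lam ^ q * mu ^ p := by
  have := h.lam_pos
  have := h.mu_pos
  positivity

theorem leftEnd_le_one (h : IsRotationOrbit lam mu delta p q Z) {l : ℕ} (hl : q ∣ l) :
    u l ≤ 1 := by
  obtain ⟨k, rfl⟩ := hl
  rw [h.leftEnd_of_dvd]
  have h1 : (lam ^ q * mu ^ p) ^ k ≤ 1 := pow_le_one₀ h.slope_pos.le h.slope_lt.le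
  nlinarith [h.last_lt]

theorem leftEnd_lt_one (h : IsRotationOrbit lam mu delta p q Z) {l : ℕ} (hl : q ∣ l)
    (hl0 : l ≠ 0) : u l < 1 := by
  obtain ⟨k, rfl⟩ := hl
  rw [h.leftEnd_of_dvd]
  have h1 : (lam ^ q * mu ^ p) ^ k < 1 :=
    pow_lt_one₀ h.slope_pos.le h.slope_lt (by rintro rfl; simp at hl0)
  nlinarith [h.last_lt]

theorem rightEnd_nonneg (h : IsRotationOrbit lam mu delta p q Z) {l : ℕ} (hl : q ∣ l) :
    0 ≤ v l := by
  obtain ⟨k, rfl⟩ := hl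
  rw [h.rightEnd_of_dvd]
  have h1 : (lam ^ q * mu ^ p) ^ k ≤ 1 := pow_le_one₀ h.slope_pos.le h.slope_lt.le
  nlinarith [h.zero_nonneg]

theorem lt_leftEnd (h : IsRotationOrbit lam mu delta p q Z) (l : ℕ) :
    Z (q - 1 + l * p) < u l := by
  have h1 := h.lam_pos
  have h2 := h.mu_pos
  have h3 : 0 < 1 - Z (q - 1) := sub_pos.2 h.last_lt
  have : 0 < lam ^ l * mu ^ ((q - 1 + l * p) / q) * (1 - Z (q - 1)) := by positivity
  unfold leftEnd
  linarith

theorem rightEnd_le (h : IsRotationOrbit lam mu delta p q Z) (l : ℕ) : v l ≤ Z (l * p) := by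
  have h1 := h.lam_pos
  have h2 := h.mu_pos
  have h3 := h.zero_nonneg
  have : 0 ≤ lam ^ l * mu ^ ((0 + l * p) / q) * Z 0 := by positivity
  unfold rightEnd
  rw [zero_add] at this ⊢
  linarith

theorem zero_mod_lt (h : IsRotationOrbit lam mu delta p q Z) {l : ℕ} (hl : q ∣ l) :
    l * p % q < q - p := by
  have := h.p_lt
  rw [(h.mul_mod_eq_zero_iff l).2 hl]; omega

theorem le_last_mod (h : IsRotationOrbit lam mu delta p q Z) {l : ℕ} (hl : q ∣ l) :
    q - p ≤ (q - 1 + l * p) % q := by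
  have := h.p_pos
  rw [h.pred_mod_of_dvd hl]; omega

/-- After a multiple of `q`, the ends are separated by the jump from `f(1⁻)` to `f(0)`. From then
until the next multiple of `q`, both ends move by the same increasing branch. -/
theorem leftEnd_lt_rightEnd (h : IsRotationOrbit lam mu delta p q Z) {l : ℕ} (hl : ¬ q ∣ l) :
    u l < v l := by
  induction l with
  | zero => exact absurd (dvd_zero q) hl
  | succ l ih =>
    by_cases hd : q ∣ l
    · rw [h.leftEnd_succ_right (h.le_last_mod hd), h.rightEnd_succ_left (h.zero_mod_lt hd)]
      have h1 : mu * (lam * u l + delta - 1) ≤ mu * (lam + delta - 1) :=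
        mul_le_mul_of_nonneg_left
          (by nlinarith [h.leftEnd_le_one hd, h.lam_pos]) h.mu_pos.le
      have h2 := mul_nonneg h.lam_pos.le (h.rightEnd_nonneg hd)
      linarith [h.gap]
    · have ih := mul_lt_mul_of_pos_left (ih hd) h.lam_pos
      have hiff := h.pred_mod_lt_iff hd hl
      rcases lt_or_ge (l * p % q) (q - p) with hc | hc
      · rw [h.leftEnd_succ_left (hiff.2 hc), h.rightEnd_succ_left hc]
        linarith
      · rw [h.leftEnd_succ_right (not_lt.1 fun h' => (not_lt.2 hc) (hiff.1 h')),
          h.rightEnd_succ_right hc]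
        exact mul_lt_mul_of_pos_left (by linarith) h.mu_pos

/-- Keeps the left end on the side of its orbit point. Either the next left end is below `1`, or the
hole lies below `Z (l * p)`, which is itself left of the discontinuity. -/
theorem image_leftEnd_lt_one (h : IsRotationOrbit lam mu delta p q Z) {l : ℕ}
    (hl : (q - 1 + l * p) % q < q - p) : lam * u l + delta < 1 := by
  by_cases hd : q ∣ l
  · exact absurd hl (not_lt.2 (h.le_last_mod hd))
  by_cases hd1 : q ∣ l + 1
  · rw [← h.leftEnd_succ_left hl]
    exact h.leftEnd_lt_one hd1 l.succ_ne_zero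
  · have h1 := h.image_lt_one ((h.pred_mod_lt_iff hd hd1).1 hl)
    have h2 := mul_lt_mul_of_pos_left ((h.leftEnd_lt_rightEnd hd).trans_le (h.rightEnd_le l))
      h.lam_pos
    linarith

theorem one_le_image_rightEnd (h : IsRotationOrbit lam mu delta p q Z) {l : ℕ}
    (hl : q - p ≤ l * p % q) : 1 ≤ lam * v l + delta := by
  by_cases hd : q ∣ l
  · exact absurd hl (not_le.2 (h.zero_mod_lt hd))
  by_cases hd1 : q ∣ l + 1
  · have h1 := h.rightEnd_nonneg hd1
    rw [h.rightEnd_succ_right hl] at h1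
    linarith [nonneg_of_mul_nonneg_right h1 h.mu_pos]
  · have h1 := h.one_le_image (not_lt.1 fun h' =>
      (not_lt.2 hl) ((h.pred_mod_lt_iff hd hd1).1 h'))
    have h2 := mul_lt_mul_of_pos_left ((h.lt_leftEnd l).trans (h.leftEnd_lt_rightEnd hd))
      h.lam_pos
    linarith

/-- By the itinerary up to time `l`, the iterate lies between `Z (q - 1 + l * p)` and the left end
of the hole, which are on one side of the discontinuity. -/
theorem same_side_last (h : IsRotationOrbit lam mu delta p q Z) {x : ℝ} (hx : Z (q - 1) ≤ x)
    (hx1 : x < 1) (l : ℕ) :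
    lam * f^[l] x + delta < 1 ↔ (q - 1 + l * p) % q < q - p := by
  induction l using Nat.strong_induction_on with
  | _ l ih =>
    have hq := h.q_pos
    have h1 := h.lam_pos
    have h2 := h.mu_pos
    have hpos : 0 < lam ^ l * mu ^ ((q - 1 + l * p) / q) := by positivity
    have hlow := mul_nonneg hpos.le (sub_nonneg.2 hx)
    have hup := mul_lt_mul_of_pos_left (sub_lt_sub_right hx1 (Z (q - 1))) hpos
    rw [h.iterate_eq_of_same_side (by omega) ih]
    constructor
    · intro hlt
      by_contra hc
      have h3 := h.one_le_image (not_lt.1 hc)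
      have := mul_nonneg h1.le hlow
      linarith
    · intro hc
      have h3 := h.image_leftEnd_lt_one hc
      unfold leftEnd at h3
      have := mul_lt_mul_of_pos_left hup h1
      linarith

theorem same_side_first (h : IsRotationOrbit lam mu delta p q Z) {x : ℝ} (hx : 0 ≤ x)
    (hx1 : x ≤ Z 0) (l : ℕ) :
    lam * f^[l] x + delta < 1 ↔ (0 + l * p) % q < q - p := by
  induction l using Nat.strong_induction_on with
  | _ l ih =>
    have hq := h.q_pos
    have h1 := h.lam_pos
    have h2 := h.mu_pos
    have hpos : 0 < lam ^ l * mu ^ ((0 + l * p) / q) := by positivity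
    have hlow := mul_nonneg hpos.le (sub_nonneg.2 hx1)
    have hup := mul_le_mul_of_nonneg_left (sub_le_sub_right hx (Z 0)) hpos.le
    rw [h.iterate_eq_of_same_side (by omega) ih]
    constructor
    · intro hlt
      by_contra hc
      rw [zero_add] at hc
      have h3 := h.one_le_image_rightEnd (not_lt.1 hc)
      unfold rightEnd at h3
      have := mul_le_mul_of_nonneg_left hup h1.le
      linarith
    · intro hc
      have h3 := h.image_lt_one hc
      have := mul_nonneg h1.le hlow
      linarith

theorem iterate_zero (h : IsRotationOrbit lam mu delta p q Z) (l : ℕ) : f^[l] 0 = v l :=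
  h.iterate_eq_of_same_side h.q_pos fun i _ => h.same_side_first le_rfl h.zero_nonneg i

theorem tendsto_iterate (h : IsRotationOrbit lam mu delta p q Z) (l : ℕ) :
    Tendsto f^[l] (𝓝[<] 1) (𝓝 (u l)) := by
  have hq := h.q_pos
  have h1 : Tendsto (fun x => Z (q - 1 + l * p) +
      lam ^ l * mu ^ ((q - 1 + l * p) / q) * (x - Z (q - 1))) (𝓝[<] 1) (𝓝 (u l)) := by
    refine Tendsto.mono_left (Continuous.tendsto ?_ 1) nhdsWithin_le_nhds
    fun_prop
  refine h1.congr' ?_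
  filter_upwards [Ioo_mem_nhdsLT h.last_lt] with x hx
  exact (h.iterate_eq_of_same_side (by omega) fun i _ => h.same_side_last hx.1.le hx.2 i).symm

theorem iterLeftOne_eq (h : IsRotationOrbit lam mu delta p q Z) (l : ℕ) :
    iterLeftOne lam mu delta l = u l := leftLim_eq_of_tendsto (h.tendsto_iterate l)

theorem leftEnd_mem_Ico (h : IsRotationOrbit lam mu delta p q Z) {l : ℕ} (hl : l ≠ 0) :
    u l ∈ Ico (0 : ℝ) 1 := by
  refine ⟨((h.mem_Ico _).1.trans_lt (h.lt_leftEnd l)).le, ?_⟩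
  by_cases hd : q ∣ l
  · exact h.leftEnd_lt_one hd hl
  · exact (h.leftEnd_lt_rightEnd hd).trans ((h.rightEnd_le l).trans_lt (h.mem_Ico _).2)

theorem first_lt_last (h : IsRotationOrbit lam mu delta p q Z) : Z 0 < Z (q - 1) := by
  have := h.p_pos
  have := h.p_lt
  exact h.lt_of_lt _ _ (by omega) (by omega)

theorem le_first_of_dvd (h : IsRotationOrbit lam mu delta p q Z) {l : ℕ} (hl : q ∣ l) :
    v l ≤ Z 0 := by
  have := h.rightEnd_le l
  rwa [h.eq_of_mod (show l * p % q = 0 % q by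
    rw [(h.mul_mod_eq_zero_iff l).2 hl, Nat.zero_mod])] at this

theorem last_lt_of_dvd (h : IsRotationOrbit lam mu delta p q Z) {l : ℕ} (hl : q ∣ l) :
    Z (q - 1) < u l := by
  have := h.lt_leftEnd l
  rwa [h.eq_of_mod (show (q - 1 + l * p) % q = (q - 1) % q by
    rw [h.pred_mod_of_dvd hl, Nat.mod_eq_of_lt (by have := h.q_pos; omega)])] at this

theorem hole_of_not_dvd (h : IsRotationOrbit lam mu delta p q Z) {l : ℕ} (hl : ¬ q ∣ l) :
    hole lam mu delta l = Ico (u l) (v l) := by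
  rw [hole, h.iterLeftOne_eq, h.iterate_zero, circIco, if_pos (h.leftEnd_lt_rightEnd hl)]

theorem rightEnd_lt_leftEnd (h : IsRotationOrbit lam mu delta p q Z) {l : ℕ} (hl : q ∣ l) :
    v l < u l :=
  (h.le_first_of_dvd hl).trans_lt (h.first_lt_last.trans (h.last_lt_of_dvd hl))

theorem hole_of_dvd (h : IsRotationOrbit lam mu delta p q Z) {l : ℕ} (hl : q ∣ l) :
    hole lam mu delta l = Ico 0 (v l) ∪ Ico (u l) 1 := by
  have := h.rightEnd_lt_leftEnd hl
  rw [hole, h.iterLeftOne_eq, h.iterate_zero, circIco, if_neg this.not_gt, if_pos this]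

theorem hole_subset (h : IsRotationOrbit lam mu delta p q Z) (l : ℕ) :
    hole lam mu delta l ⊆ circIco (Z (q - 1 + l * p)) (Z (l * p)) := by
  by_cases hd : q ∣ l
  · have h1 := (h.last_lt_of_dvd hd).le
    have h2 := h.le_first_of_dvd hd
    rw [h.hole_of_dvd hd, h.eq_of_mod (show l * p % q = 0 % q by
      rw [(h.mul_mod_eq_zero_iff l).2 hd, Nat.zero_mod]),
      h.eq_of_mod (show (q - 1 + l * p) % q = (q - 1) % q by
      rw [h.pred_mod_of_dvd hd, Nat.mod_eq_of_lt (by have := h.q_pos; omega)]),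
      circIco, if_neg h.first_lt_last.not_gt, if_pos h.first_lt_last]
    exact union_subset_union (Ico_subset_Ico_right h2) (Ico_subset_Ico_left h1)
  · have h1 := h.lt_leftEnd l
    have h2 := h.rightEnd_le l
    rw [h.hole_of_not_dvd hd, circIco, if_pos (h1.trans ((h.leftEnd_lt_rightEnd hd).trans_le h2))]
    exact Ico_subset_Ico h1.le h2

/-! ### Images and disjointness of the holes -/

theorem mapsTo (h : IsRotationOrbit lam mu delta p q Z) : MapsTo f (Ico 0 1) (Ico 0 1) := by
  have h1 := h.lam_pos
  have h2 := h.mu_pos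
  have h3 := h.gap
  have h4 := h.lt_delta
  have h5 := h.delta_lt
  have h6 := h.lam_lt_one
  rintro x ⟨hx0, hx1⟩
  rcases lt_or_ge (lam * x + delta) 1 with hc | hc
  · rw [affMap_left h1 hc]
    exact ⟨by nlinarith, hc⟩
  · rw [affMap_right h1 hc]
    have := mul_lt_mul_of_pos_left (show lam * x + delta - 1 < lam + delta - 1 by nlinarith) h2
    exact ⟨mul_nonneg h2.le (by linarith), by linarith⟩

/-- Each branch is injective, and by `gap` the image of the right branch lies below that of the left
one. -/
theorem injOn (h : IsRotationOrbit lam mu delta p q Z) : InjOn f (Ico 0 1) := by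
  have h1 := h.lam_pos
  have h2 := h.mu_pos
  have h3 := h.gap
  have key : ∀ x ∈ Ico (0 : ℝ) 1, ∀ y ∈ Ico (0 : ℝ) 1, lam * x + delta < 1 →
      1 ≤ lam * y + delta → f y < f x := by
    rintro x ⟨hx0, hx1⟩ y ⟨hy0, hy1⟩ hx hy
    rw [affMap_left h1 hx, affMap_right h1 hy]
    have := mul_lt_mul_of_pos_left (show lam * y + delta - 1 < lam + delta - 1 by nlinarith) h2
    nlinarith
  intro x hx y hy hxy
  rcases lt_or_ge (lam * x + delta) 1 with hc | hc <;>
    rcases lt_or_ge (lam * y + delta) 1 with hd | hd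
  · rw [affMap_left h1 hc, affMap_left h1 hd] at hxy
    exact mul_left_cancel₀ h1.ne' (by linarith)
  · exact absurd hxy (key x hx y hy hc hd).ne'
  · exact absurd hxy (key y hy x hx hd hc).ne
  · rw [affMap_right h1 hc, affMap_right h1 hd] at hxy
    have := mul_left_cancel₀ h2.ne' hxy
    exact mul_left_cancel₀ h1.ne' (by linarith)

/-- An interval that contains the discontinuity is mapped onto a circular interval around `0`. -/
theorem image_Ico_of_mem (h : IsRotationOrbit lam mu delta p q Z) {a b : ℝ}
    (ha : lam * a + delta ≤ 1) (hb : 1 ≤ lam * b + delta) :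
    f '' Ico a b = Ico 0 (mu * (lam * b + delta - 1)) ∪ Ico (lam * a + delta) 1 := by
  have h1 := h.lam_pos
  have e : lam * ((1 - delta) / lam) + delta = 1 := by
    rw [mul_div_cancel₀ _ h1.ne']; ring
  have hm1 : a ≤ (1 - delta) / lam := by rw [le_div_iff₀ h1]; linarith
  have hm2 : (1 - delta) / lam ≤ b := by rw [div_le_iff₀ h1]; linarith
  rw [← Ico_union_Ico_eq_Ico hm1 hm2, image_union, image_affMap_left h1 e.le,
    image_affMap_right h1 h.mu_pos e.ge, e, sub_self, mul_zero, union_comm]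

theorem leftEnd_one (h : IsRotationOrbit lam mu delta p q Z) :
    u 1 = mu * (lam + delta - 1) := by
  rw [← zero_add 1, h.leftEnd_succ_right (h.le_last_mod (dvd_zero q)), h.leftEnd_zero, mul_one]

theorem rightEnd_one (h : IsRotationOrbit lam mu delta p q Z) : v 1 = delta := by
  rw [← zero_add 1, h.rightEnd_succ_left (h.zero_mod_lt (dvd_zero q)), rightEnd_zero, mul_zero,
    zero_add]

theorem not_dvd_one (h : IsRotationOrbit lam mu delta p q Z) : ¬ q ∣ 1 := by
  have := h.p_pos
  have := h.p_lt
  rw [Nat.dvd_one]; omega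

theorem not_dvd_succ (h : IsRotationOrbit lam mu delta p q Z) {l : ℕ} (hl : q ∣ l) :
    ¬ q ∣ l + 1 := fun h' => h.not_dvd_one ((Nat.dvd_add_right hl).1 h')

theorem hole_one (h : IsRotationOrbit lam mu delta p q Z) :
    hole lam mu delta 1 = Ico (mu * (lam + delta - 1)) delta := by
  rw [h.hole_of_not_dvd h.not_dvd_one, h.leftEnd_one, h.rightEnd_one]

theorem image_unit (h : IsRotationOrbit lam mu delta p q Z) :
    f '' Ico 0 1 = Ico 0 1 \ hole lam mu delta 1 := by
  have h1 := h.lt_delta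
  have h2 := h.gap
  have h3 := h.delta_lt
  have h4 : 0 ≤ mu * (lam + delta - 1) := mul_nonneg h.mu_pos.le (by linarith)
  rw [h.image_Ico_of_mem (by linarith) (by linarith), h.hole_one, mul_zero, zero_add, mul_one]
  ext x
  simp only [mem_union, Set.mem_sdiff]
  constructor
  · rintro (⟨h5, h6⟩ | ⟨h5, h6⟩)
    · exact ⟨⟨h5, by linarith⟩, fun h' => by linarith [h'.1]⟩
    · exact ⟨⟨by linarith [h.lam_lt_one], h6⟩, fun h' => by linarith [h'.2]⟩
  · rintro ⟨⟨h5, h6⟩, h7⟩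
    rcases lt_or_ge x (mu * (lam + delta - 1)) with hc | hc
    · exact Or.inl ⟨h5, hc⟩
    · exact Or.inr ⟨not_lt.1 fun h' => h7 ⟨hc, h'⟩, h6⟩

/-- The hole lies on one branch unless `q ∣ l + 1`. In that case it straddles the discontinuity and
its image wraps around `0`. -/
theorem image_hole_of_not_dvd (h : IsRotationOrbit lam mu delta p q Z) {l : ℕ} (hl : ¬ q ∣ l) :
    f '' hole lam mu delta l = hole lam mu delta (l + 1) := by
  have hlt := h.leftEnd_lt_rightEnd hl
  have hpm := h.pred_mod_of_not_dvd hl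
  have hp := h.p_pos
  rw [h.hole_of_not_dvd hl]
  by_cases hd : q ∣ l + 1
  · have hm := (h.mul_mod_eq_sub_iff l).2 hd
    have ha : (q - 1 + l * p) % q < q - p := by omega
    rw [h.hole_of_dvd hd, h.leftEnd_succ_left ha, h.rightEnd_succ_right hm.ge]
    exact h.image_Ico_of_mem (h.image_leftEnd_lt_one ha).le (h.one_le_image_rightEnd hm.ge)
  · rw [h.hole_of_not_dvd hd]
    have hiff := h.pred_mod_lt_iff hl hd
    rcases lt_or_ge (l * p % q) (q - p) with hc | hc
    · rw [h.leftEnd_succ_left (hiff.2 hc), h.rightEnd_succ_left hc]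
      refine image_affMap_left h.lam_pos ?_
      have := mul_le_mul_of_nonneg_left (h.rightEnd_le l) h.lam_pos.le
      linarith [h.image_lt_one hc]
    · have hc' : q - p ≤ (q - 1 + l * p) % q := not_lt.1 fun h' => (not_lt.2 hc) (hiff.1 h')
      rw [h.leftEnd_succ_right hc', h.rightEnd_succ_right hc]
      refine image_affMap_right h.lam_pos h.mu_pos ?_
      have := mul_lt_mul_of_pos_left (h.lt_leftEnd l) h.lam_pos
      linarith [h.one_le_image hc']

/-- The hole is circular around `0`, and its two pieces are mapped to intervals adjoining the first
hole on either side. -/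
theorem image_hole_of_dvd (h : IsRotationOrbit lam mu delta p q Z) {l : ℕ} (hl : q ∣ l) :
    hole lam mu delta 1 ∪ f '' hole lam mu delta l = hole lam mu delta (l + 1) := by
  have h1 := h.lam_pos
  have h2 := h.mu_pos
  have hv0 := mul_nonneg h1.le (h.rightEnd_nonneg hl)
  have hv1 : lam * v l + delta ≤ 1 := by
    have := mul_le_mul_of_nonneg_left (h.rightEnd_le l) h1.le
    linarith [h.image_lt_one (h.zero_mod_lt hl)]
  have hu0 : 1 ≤ lam * u l + delta := by
    have := mul_lt_mul_of_pos_left (h.lt_leftEnd l) h1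
    linarith [h.one_le_image (h.le_last_mod hl)]
  have hu1 : mu * (lam * u l + delta - 1) ≤ mu * (lam + delta - 1) :=
    mul_le_mul_of_nonneg_left (by nlinarith [h.leftEnd_le_one hl]) h2.le
  rw [h.hole_of_dvd hl, image_union, image_affMap_left h1 hv1, image_affMap_right h1 h2 hu0,
    h.hole_one, h.hole_of_not_dvd (h.not_dvd_succ hl), h.leftEnd_succ_right (h.le_last_mod hl),
    h.rightEnd_succ_left (h.zero_mod_lt hl), mul_zero, zero_add, mul_one, ← union_assoc,
    Ico_union_Ico_eq_Ico h.gap.le (by linarith), union_comm,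
    Ico_union_Ico_eq_Ico hu1 (by linarith [h.gap])]

theorem hole_subset_unit (h : IsRotationOrbit lam mu delta p q Z) {l : ℕ} (hl : l ≠ 0) :
    hole lam mu delta l ⊆ Ico 0 1 := by
  have hu := h.leftEnd_mem_Ico hl
  by_cases hd : q ∣ l
  · rw [h.hole_of_dvd hd]
    exact union_subset (Ico_subset_Ico_right ((h.le_first_of_dvd hd).trans (h.mem_Ico 0).2.le))
      (Ico_subset_Ico_left hu.1)
  · rw [h.hole_of_not_dvd hd]
    exact Ico_subset_Ico hu.1 ((h.rightEnd_le l).trans (h.mem_Ico _).2.le)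

theorem image_hole_subset (h : IsRotationOrbit lam mu delta p q Z) (l : ℕ) :
    f '' hole lam mu delta l ⊆ hole lam mu delta (l + 1) := by
  by_cases hd : q ∣ l
  · rw [← h.image_hole_of_dvd hd]; exact subset_union_right
  · exact (h.image_hole_of_not_dvd hd).le

/-- Induction step for `image_iterate`. The truncated difference `n - q` makes the window start at
`1` as long as `n ≤ q`. -/
theorem hole_one_union_image (h : IsRotationOrbit lam mu delta p q Z) (n : ℕ) :
    hole lam mu delta 1 ∪ ⋃ l ∈ Icc (n - q + 1) n, f '' hole lam mu delta l =
      ⋃ l ∈ Icc (n + 1 - q + 1) (n + 1), hole lam mu delta l := by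
  have hq := h.q_pos
  apply Subset.antisymm
  · refine union_subset ?_ (iUnion₂_subset fun l hl => ?_)
    · rcases lt_or_ge n q with hn | hn
      · exact fun x hx => mem_biUnion (mem_Icc.2 ⟨by omega, by omega⟩) hx
      · have e := Nat.div_add_mod n q
        have e1 := Nat.mod_lt n hq
        have e2 : 0 < n / q := Nat.div_pos hn hq
        have e3 : 0 < q * (n / q) := by positivity
        -- The first hole is contained in the hole that follows the last multiple of `q` not
        -- exceeding `n`, and that one is still in the window.
        refine Subset.trans ?_ (fun x hx => mem_biUnion
          (show q * (n / q) + 1 ∈ Icc (n + 1 - q + 1) (n + 1) from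
            mem_Icc.2 ⟨by omega, by omega⟩) hx)
        rw [← h.image_hole_of_dvd (dvd_mul_right _ _)]
        exact subset_union_left
    · rw [mem_Icc] at hl
      refine Subset.trans (h.image_hole_subset l) fun x hx => mem_biUnion ?_ hx
      rw [mem_Icc]
      refine ⟨?_, by omega⟩
      by_contra hc
      have : n < q := by omega
      omega
  · refine iUnion₂_subset fun l hl => ?_
    rw [mem_Icc] at hl
    rcases Nat.eq_or_lt_of_le (show 1 ≤ l by omega) with rfl | h1
    · exact subset_union_left
    · obtain ⟨k, rfl⟩ : ∃ k, l = k + 1 := ⟨l - 1, by omega⟩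
      have hk : k ∈ Icc (n - q + 1) n := mem_Icc.2 ⟨by omega, by omega⟩
      have hsub : f '' hole lam mu delta k ⊆
          ⋃ l ∈ Icc (n - q + 1) n, f '' hole lam mu delta l := fun x hx => mem_biUnion hk hx
      by_cases hd : q ∣ k
      · rw [← h.image_hole_of_dvd hd]
        exact union_subset_union_right _ hsub
      · rw [← h.image_hole_of_not_dvd hd]
        exact hsub.trans subset_union_right

theorem image_iterate (h : IsRotationOrbit lam mu delta p q Z) (n : ℕ) :
    f^[n] '' Ico 0 1 = Ico 0 1 \ ⋃ l ∈ Icc (n - q + 1) n, hole lam mu delta l := by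
  induction n with
  | zero => simp
  | succ n ih =>
    have hsub : (⋃ l ∈ Icc (n - q + 1) n, hole lam mu delta l) ⊆ Ico 0 1 :=
      iUnion₂_subset fun l hl => h.hole_subset_unit (by rw [mem_Icc] at hl; omega)
    -- By injectivity, the image of the difference is the difference of the images.
    rw [Function.iterate_succ', image_comp, ih, h.injOn.image_sdiff_subset hsub, h.image_unit,
      image_iUnion₂, sdiff_sdiff, h.hole_one_union_image]

/-- The holes lie in distinct gaps between neighbouring orbit points; the hole with the larger
residue does not wrap around. -/
theorem hole_disjoint (h : IsRotationOrbit lam mu delta p q Z) {l m : ℕ}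
    (hlm : l * p % q < m * p % q) : Disjoint (hole lam mu delta l) (hole lam mu delta m) := by
  have hm : ¬ q ∣ m := fun h' => by
    rw [(h.mul_mod_eq_zero_iff m).2 h'] at hlm; omega
  have hmp := h.pred_mod_of_not_dvd hm
  have hlt := Nat.mod_lt (m * p) h.q_pos
  have hum := h.lt_leftEnd m
  have hvm := h.rightEnd_le m
  rw [← h.mod_eq] at hum hvm
  rw [h.hole_of_not_dvd hm, Set.disjoint_left]
  by_cases hd : q ∣ l
  · have h1 := h.le_first_of_dvd hd
    have h2 := h.last_lt_of_dvd hd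
    have h3 := h.le_of_le (Nat.zero_le ((q - 1 + m * p) % q)) (by omega)
    have h4 : Z (m * p % q) ≤ Z (q - 1) := h.le_of_le (by omega) (by omega)
    rw [h.hole_of_dvd hd]
    rintro x (⟨-, hx⟩ | ⟨hx, -⟩) ⟨hx1, hx2⟩ <;> linarith
  · have h1 := h.rightEnd_le l
    rw [← h.mod_eq] at h1
    have h2 : Z (l * p % q) ≤ Z ((q - 1 + m * p) % q) := h.le_of_le (by omega) (by omega)
    rw [h.hole_of_not_dvd hd]
    rintro x ⟨-, hx⟩ ⟨hx1, -⟩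
    linarith

theorem pairwiseDisjoint_hole (h : IsRotationOrbit lam mu delta p q Z) (n : ℕ) :
    (Icc (n - q + 1) n).PairwiseDisjoint (hole lam mu delta) := by
  intro l hl m hm hne
  rw [mem_Icc] at hl hm
  -- Distinct indices in a window of length at most `q` are distinct modulo `q`, and `p` is
  -- invertible there.
  have hmod : l * p % q ≠ m * p % q := fun h' => by
    have h1 : l % q = m % q :=
      Nat.ModEq.cancel_right_of_coprime (by simpa using h.coprime.symm) h'
    have h2 := Nat.div_add_mod l q
    have h3 := Nat.div_add_mod m q
    rcases lt_trichotomy (l / q) (m / q) with hc | hc | hc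
    · have : q * (l / q + 1) ≤ q * (m / q) := Nat.mul_le_mul_left q hc
      rw [mul_add] at this; omega
    · rw [hc] at h2; omega
    · have : q * (m / q + 1) ≤ q * (l / q) := Nat.mul_le_mul_left q hc
      rw [mul_add] at this; omega
  rcases lt_or_gt_of_ne hmod with hc | hc
  · exact h.hole_disjoint hc
  · exact (h.hole_disjoint hc).symm

/-! ### Itineraries of all points, and Lebesgue measure -/

theorem measurableSet_hole (lam mu delta : ℝ) (l : ℕ) : MeasurableSet (hole lam mu delta l) := by
  unfold hole circIco
  split_ifs
  · exact measurableSet_Ico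
  · exact measurableSet_Ico.union measurableSet_Ico
  · exact MeasurableSet.empty

theorem measurable_affMap (lam mu delta : ℝ) : Measurable (affMap lam mu delta) := by
  unfold affMap
  exact Measurable.ite measurableSet_Iio (by fun_prop) (by fun_prop)

/-- `x` lies in the circular interval from `Z N` to `Z (N + 1)`. -/
def InGap (q : ℕ) (Z : ℕ → ℝ) (N : ℕ) (x : ℝ) : Prop :=
  if q ∣ N + 1 then Z N ≤ x ∨ x < Z (N + 1) else Z N ≤ x ∧ x < Z (N + 1)

theorem exists_inGap (h : IsRotationOrbit lam mu delta p q Z) (x : ℝ) :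
    ∃ N < q, InGap q Z N x := by
  have hq := h.q_pos
  by_cases hc : ∃ N < q, x < Z N
  · classical
    obtain ⟨h1, h2⟩ := Nat.find_spec hc
    -- The first orbit point above `x` is the upper end of its gap.
    set M := Nat.find hc with hM
    rcases Nat.eq_zero_or_pos M with h0 | h0
    · refine ⟨q - 1, by omega, ?_⟩
      rw [InGap, if_pos (by rw [Nat.sub_add_cancel hq])]
      right
      rwa [Nat.sub_add_cancel hq, h.eq_of_mod (show q % q = 0 % q by simp), ← h0]
    · refine ⟨M - 1, by omega, ?_⟩
      have h3 := Nat.find_min hc (m := M - 1) (by omega)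
      rw [InGap, Nat.sub_add_cancel h0, if_neg (Nat.not_dvd_of_pos_of_lt h0 h1)]
      exact ⟨not_lt.1 fun h' => h3 ⟨by omega, h'⟩, h2⟩
  · push Not at hc
    refine ⟨q - 1, by omega, ?_⟩
    rw [InGap, if_pos (by rw [Nat.sub_add_cancel hq])]
    exact Or.inl (hc _ (by omega))

theorem succ_mod_of_not_dvd (h : IsRotationOrbit lam mu delta p q Z) {N : ℕ} (hN : ¬ q ∣ N + 1) :
    (N + 1) % q = N % q + 1 := by
  have h0 := h.q_pos
  have h1 := Nat.mod_lt N h0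
  have h2 : (N + 1) % q = (N % q + 1) % q := by rw [Nat.add_mod]; simp
  rcases Nat.lt_or_ge (N % q + 1) q with hc | hc
  · rw [h2, Nat.mod_eq_of_lt hc]
  · exfalso
    rw [show N % q + 1 = q by omega, Nat.mod_self] at h2
    exact hN (Nat.dvd_of_mod_eq_zero h2)

theorem mod_of_dvd_succ (h : IsRotationOrbit lam mu delta p q Z) {N : ℕ} (hN : q ∣ N + 1) :
    N % q = q - 1 := by
  obtain ⟨k, hk⟩ := hN
  have h0 := h.q_pos
  have hk0 : k ≠ 0 := by rintro rfl; omega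
  obtain ⟨j, rfl⟩ := Nat.exists_eq_succ_of_ne_zero hk0
  rw [show N = q - 1 + q * j by rw [Nat.succ_eq_add_one, mul_add] at hk; omega,
    Nat.add_mul_mod_self_left, Nat.mod_eq_of_lt (by omega)]

theorem same_side_of_dvd_succ (h : IsRotationOrbit lam mu delta p q Z) {N : ℕ} (hN : q ∣ N + 1)
    {x : ℝ} (hx : x ∈ Ico (0 : ℝ) 1) :
    (Z N ≤ x → ∀ i, (lam * f^[i] x + delta < 1 ↔ (N + i * p) % q < q - p)) ∧
      (x < Z (N + 1) → ∀ i, (lam * f^[i] x + delta < 1 ↔ (N + 1 + i * p) % q < q - p)) := by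
  have hq := h.q_pos
  have h1 : N % q = (q - 1) % q := by
    rw [h.mod_of_dvd_succ hN, Nat.mod_eq_of_lt (by omega)]
  have h2 : (N + 1) % q = 0 % q := by rw [Nat.zero_mod]; exact Nat.mod_eq_zero_of_dvd hN
  refine ⟨fun hle i => ?_, fun hlt i => ?_⟩
  · rw [h.eq_of_mod h1] at hle
    rw [h.same_side_last hle hx.2 i, Nat.add_mod N, h1, ← Nat.add_mod]
  · rw [h.eq_of_mod h2] at hlt
    rw [h.same_side_first hx.1 hlt.le i, Nat.add_mod (N + 1), h2, ← Nat.add_mod]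

/-- Each point of the unit interval has the itinerary of an end point of its gap. -/
theorem exists_same_side_of_inGap (h : IsRotationOrbit lam mu delta p q Z) (j : ℕ) :
    ∀ (N : ℕ) (x : ℝ), x ∈ Ico (0 : ℝ) 1 → InGap q Z N x → q ∣ N + 1 + j * p →
      ∃ M, (M = N ∨ M = N + 1) ∧
        ∀ i, (lam * f^[i] x + delta < 1 ↔ (M + i * p) % q < q - p) := by
  have hp := h.p_pos
  have hpq := h.p_lt
  have h1 := h.lam_pos
  have h2 := h.mu_pos
  have base : ∀ (N : ℕ) (x : ℝ), x ∈ Ico (0 : ℝ) 1 → InGap q Z N x → q ∣ N + 1 →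
      ∃ M, (M = N ∨ M = N + 1) ∧
        ∀ i, (lam * f^[i] x + delta < 1 ↔ (M + i * p) % q < q - p) := by
    intro N x hx hg hd
    rw [InGap, if_pos hd] at hg
    have hs := h.same_side_of_dvd_succ hd hx
    rcases hg with hg | hg
    · exact ⟨N, Or.inl rfl, hs.1 hg⟩
    · exact ⟨N + 1, Or.inr rfl, hs.2 hg⟩
  induction j with
  | zero => intro N x hx hg hd; exact base N x hx hg (by simpa using hd)
  | succ j ih =>
    intro N x hx hg hd
    by_cases hN : q ∣ N + 1
    · exact base N x hx hg hN
    rw [InGap, if_neg hN] at hg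
    have hsucc := h.succ_mod_of_not_dvd hN
    have hg1 := mul_le_mul_of_nonneg_left hg.1 h1.le
    have hg2 := mul_lt_mul_of_pos_left hg.2 h1
    have hfx := h.mapsTo hx
    have e : ∀ M i : ℕ, M + (i + 1) * p = M + p + i * p := fun M i => by ring
    have ext : ∀ M, (lam * x + delta < 1 ↔ M % q < q - p) →
        (∀ i, (lam * f^[i] (f x) + delta < 1 ↔ (M + p + i * p) % q < q - p)) →
        ∀ i, (lam * f^[i] x + delta < 1 ↔ (M + i * p) % q < q - p) := by
      intro M h0 hs i
      cases i with
      | zero => simpa using h0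
      | succ i => rw [Function.iterate_succ_apply, e]; exact hs i
    -- In this case the discontinuity is in the gap of `x`: points to its left land above the last
    -- orbit point and follow `Z N`, the others land below `Z 0` and follow `Z (N + 1)`. Otherwise
    -- the whole gap moves by one branch.
    by_cases hNp : q ∣ N + p + 1
    · have hmod : (N + 1) % q = q - p := by
        have h3 := Nat.mod_lt (N + 1) h.q_pos
        have h4 : ((N + 1) % q + p) % q = 0 := by
          rw [Nat.mod_add_mod, add_right_comm]; exact Nat.mod_eq_zero_of_dvd hNp
        rcases lt_or_ge ((N + 1) % q + p) q with hc | hc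
        · rw [Nat.mod_eq_of_lt hc] at h4; omega
        · rw [Nat.mod_eq_sub_mod hc, Nat.mod_eq_of_lt (by omega)] at h4; omega
      have hs := h.same_side_of_dvd_succ hNp hfx
      rcases lt_or_ge (lam * x + delta) 1 with hc | hc
      · refine ⟨N, Or.inl rfl, ext N (iff_of_true hc (by omega)) (hs.1 ?_)⟩
        rw [affMap_left h1 hc, h.left N (by omega)]
        linarith
      · refine ⟨N + 1, Or.inr rfl, ext _ (iff_of_false (not_lt.2 hc) (by omega)) ?_⟩
        rw [add_right_comm N 1 p]
        refine hs.2 ?_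
        rw [affMap_right h1 hc, add_right_comm, h.right _ hmod.ge]
        exact mul_lt_mul_of_pos_left (by linarith) h2
    · have hne : (N + 1) % q ≠ q - p := fun h' => hNp <| by
        rw [add_right_comm, Nat.dvd_iff_mod_eq_zero, Nat.add_mod, h', Nat.mod_eq_of_lt hpq,
          Nat.sub_add_cancel hpq.le, Nat.mod_self]
      have hd' : q ∣ N + p + 1 + j * p := by
        rwa [show N + p + 1 + j * p = N + 1 + (j + 1) * p by ring]
      have key : (lam * x + delta < 1 ↔ N % q < q - p) ∧ InGap q Z (N + p) (f x) := by
        rw [InGap, if_neg hNp, add_right_comm N p 1]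
        rcases lt_or_ge (N % q) (q - p) with hc | hc
        · have h3 : (N + 1) % q < q - p := by omega
          have h4 := h.image_lt_one h3
          have h5 : lam * x + delta < 1 := by linarith
          rw [affMap_left h1 h5, h.left N hc, h.left _ h3]
          exact ⟨iff_of_true h5 hc, by linarith, by linarith⟩
        · have h3 : q - p ≤ (N + 1) % q := by omega
          have h4 := h.one_le_image hc
          have h5 : 1 ≤ lam * x + delta := by linarith
          rw [affMap_right h1 h5, h.right N hc, h.right _ h3]
          exact ⟨iff_of_false (not_lt.2 h5) (not_lt.2 hc),
            mul_le_mul_of_nonneg_left (by linarith) h2.le,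
            mul_lt_mul_of_pos_left (by linarith) h2⟩
      obtain ⟨M, hM | hM, hs⟩ := ih (N + p) (f x) hfx key.2 hd'
      · subst hM
        exact ⟨N, Or.inl rfl, ext N key.1 hs⟩
      · subst hM
        rw [add_right_comm N p 1] at hs
        exact ⟨N + 1, Or.inr rfl, ext (N + 1) (key.1.trans (by omega)) hs⟩

/-- The point follows some orbit point for `q` steps. That orbit point returns to itself after using
the right branch `p` times. -/
theorem exists_iterate_eq (h : IsRotationOrbit lam mu delta p q Z) {x : ℝ}
    (hx : x ∈ Ico (0 : ℝ) 1) :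
    ∃ M < q, f^[q] x = lam ^ q * mu ^ p * (x - Z M) + Z M := by
  have hq := h.q_pos
  obtain ⟨N, hN, hg⟩ := h.exists_inGap x
  -- After `j` rotation steps, the gap reaches the one around `0`.
  obtain ⟨j, -, hj⟩ := Nat.exists_mul_mod_eq_of_coprime (q - 1 - N) h.coprime hq.ne'
  have hd : q ∣ N + 1 + j * p := by
    rw [Nat.dvd_iff_mod_eq_zero, mul_comm, Nat.add_mod, hj, ← Nat.add_mod,
      show N + 1 + (q - 1 - N) = q by omega, Nat.mod_self]
  obtain ⟨M, -, hs⟩ := h.exists_same_side_of_inGap j N x hx hg hd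
  refine ⟨M % q, Nat.mod_lt _ hq, ?_⟩
  rw [h.iterate_eq_of_same_side (Nat.mod_lt M hq) (l := q) fun i _ => by
    rw [Nat.mod_add_mod]; exact hs i, Nat.add_mul_div_left _ _ hq,
    Nat.div_eq_of_lt (Nat.mod_lt M hq), zero_add,
    h.eq_of_mod (show (M % q + q * p) % q = M % q % q by rw [Nat.add_mul_mod_self_left])]
  ring

/-- Split `A` according to the homothety with which `f^q` agrees; each piece is scaled by the same
ratio. -/
theorem volume_image_iterate_le (h : IsRotationOrbit lam mu delta p q Z) {A : Set ℝ}
    (hA : MeasurableSet A) (hAI : A ⊆ Ico 0 1) :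
    volume (f^[q] '' A) ≤ ENNReal.ofReal (lam ^ q * mu ^ p) * volume A := by
  set c := lam ^ q * mu ^ p with hc
  have hcpos : 0 < c := h.slope_pos
  have hclt : c < 1 := h.slope_lt
  set T : ℕ → Set ℝ := fun M => A ∩ {x | f^[q] x = c * (x - Z M) + Z M} with hT
  have hTm : ∀ M, MeasurableSet (T M) := fun M =>
    hA.inter (measurableSet_eq_fun ((measurable_affMap lam mu delta).iterate q) (by fun_prop))
  have hvol : ∀ M, volume (f^[q] '' T M) = ENNReal.ofReal c * volume (T M) := by
    intro M
    have e : f^[q] '' T M = AffineMap.homothety (Z M) c '' T M := by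
      refine image_congr fun x hx => ?_
      rw [hx.2, AffineMap.homothety_apply]
      simp
    rw [e, Measure.addHaar_image_homothety]
    simp [abs_of_pos hcpos]
  have hsub : f^[q] '' A ⊆ ⋃ M ∈ Finset.range q, f^[q] '' T M := by
    rintro _ ⟨x, hx, rfl⟩
    obtain ⟨M, hM, hMx⟩ := h.exists_iterate_eq (hAI hx)
    exact mem_biUnion (Finset.mem_coe.2 (Finset.mem_range.2 hM)) ⟨x, ⟨hx, hMx⟩, rfl⟩
  have hdisj : (Finset.range q : Set ℕ).PairwiseDisjoint T := by
    intro M hM N hN hne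
    rw [Finset.mem_coe, Finset.mem_range] at hM hN
    refine Set.disjoint_left.2 fun x hx hx' => ?_
    have e := hx.2.symm.trans hx'.2
    -- Homotheties of the same ratio `c ≠ 1` that agree at a point have the same centre.
    have hZ : Z M = Z N := by
      have : (1 - c) * Z M = (1 - c) * Z N := by linarith
      exact mul_left_cancel₀ (by linarith) this
    rcases lt_or_gt_of_ne hne with hlt | hlt
    · exact (h.lt_of_lt _ _ hlt hN).ne hZ
    · exact (h.lt_of_lt _ _ hlt hM).ne' hZ
  calc volume (f^[q] '' A) ≤ volume (⋃ M ∈ Finset.range q, f^[q] '' T M) := measure_mono hsub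
    _ ≤ ∑ M ∈ Finset.range q, volume (f^[q] '' T M) := measure_biUnion_finset_le _ _
    _ = ENNReal.ofReal c * ∑ M ∈ Finset.range q, volume (T M) := by
        rw [Finset.mul_sum]; exact Finset.sum_congr rfl fun M _ => hvol M
    _ = ENNReal.ofReal c * volume (⋃ M ∈ Finset.range q, T M) := by
        rw [measure_biUnion_finset hdisj fun M _ => hTm M]
    _ ≤ ENNReal.ofReal c * volume A := by
        gcongr
        exact iUnion₂_subset fun M _ => inter_subset_left

theorem measurableSet_image_iterate (h : IsRotationOrbit lam mu delta p q Z) (n : ℕ) :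
    MeasurableSet (f^[n] '' Ico 0 1) := by
  rw [h.image_iterate]
  exact measurableSet_Ico.diff (MeasurableSet.biUnion (to_countable _)
    fun l _ => measurableSet_hole lam mu delta l)

theorem volume_image_le (h : IsRotationOrbit lam mu delta p q Z) (n : ℕ) :
    volume (f^[n] '' Ico 0 1) ≤ ENNReal.ofReal ((lam ^ q * mu ^ p) ^ (n / q)) := by
  have hsub : ∀ m, f^[m] '' Ico 0 1 ⊆ Ico 0 1 := fun m => (h.mapsTo.iterate m).image_subset
  have key : ∀ k r, volume (f^[q * k + r] '' Ico 0 1) ≤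
      ENNReal.ofReal ((lam ^ q * mu ^ p) ^ k) := by
    intro k r
    induction k with
    | zero =>
      refine (measure_mono (hsub _)).trans ?_
      simp
    | succ k ih =>
      rw [show q * (k + 1) + r = q + (q * k + r) by ring, Function.iterate_add, image_comp,
        pow_succ', ENNReal.ofReal_mul h.slope_pos.le]
      refine (h.volume_image_iterate_le (h.measurableSet_image_iterate _) (hsub _)).trans ?_
      gcongr
  have := key (n / q) (n % q)
  rwa [Nat.div_add_mod] at this

end IsRotationOrbit

/-! ### The points `zeta_m` as a rotation orbit, and the theorem -/

theorem isRotationOrbit_zeta {lam mu delta : ℝ} {p q : ℕ}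
    (hlam0 : 0 < lam) (hlam1 : lam < 1) (hmu : 0 < mu)
    (hdelta0 : 1 - lam < delta) (hdelta1 : delta < dBound lam mu)
    (hpq : Nat.Coprime p q)
    (hrho0 : 0 < (p : ℝ) / q) (hrho1 : (p : ℝ) / q < rBound lam mu)
    (hleft : deltaFunLeft lam mu ((p : ℝ) / q) ≤ delta)
    (hright : delta < deltaFun lam mu ((p : ℝ) / q)) :
    IsRotationOrbit lam mu delta p q fun N => zeta lam mu delta p q (N : ℤ) := by
  have hp : 0 < p := Nat.pos_of_ne_zero (by rintro rfl; simp at hrho0)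
  have hq : 0 < q := Nat.pos_of_ne_zero (by rintro rfl; simp at hrho0)
  have hq' : (0 : ℝ) < q := by exact_mod_cast hq
  have hlt : p < q := by
    have := lt_one_of_lt_rBound hlam0 hlam1 hrho1
    rw [div_lt_one hq'] at this
    exact_mod_cast this
  obtain ⟨hd1, hgap⟩ := mu_mul_lt_delta hlam1 hmu hdelta0 hdelta1
  have hz : ∀ N : ℕ, zeta lam mu delta p q (N : ℤ) =
      phi lam mu delta ((p : ℝ) / q) (((N % q : ℕ) : ℝ) / q) := fun N => by
    rw [zeta, ← Int.natCast_mod, Int.cast_natCast]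
  refine
    { lam_pos := hlam0, lam_lt_one := hlam1, mu_pos := hmu, lt_delta := hdelta0, delta_lt := hd1
      gap := hgap, p_pos := hp, p_lt := hlt, coprime := hpq
      slope_lt := slope_lt_one hlam0 hlam1 hmu hq hrho1
      mod_eq := fun N => ?_, lt_of_lt := fun m n hmn hn => ?_, zero_nonneg := ?_, last_lt := ?_
      left := fun N hN => ?_, right := fun N hN => ?_ }
  · rw [hz, hz, Nat.mod_mod]
  · simp only [hz]
    induction n, hmn using Nat.le_induction with
    | base =>
      rw [Nat.mod_eq_of_lt hn, Nat.mod_eq_of_lt (by omega)]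
      exact phi_lt_phi hlam0 hlam1 hmu hgap hlt hpq hrho1 hn
    | succ n hmn ih =>
      refine (ih (by omega)).trans ?_
      rw [Nat.mod_eq_of_lt hn, Nat.mod_eq_of_lt (by omega)]
      exact phi_lt_phi hlam0 hlam1 hmu hgap hlt hpq hrho1 hn
  · rw [hz, Nat.zero_mod]
    exact phi_zero_nonneg hlam0 hlam1 hmu hp hlt hrho1 hleft
  · rw [hz, Nat.mod_eq_of_lt (by omega)]
    exact phi_last_lt_one hlam0 hlam1 hmu hlt hrho1 hright
  · rw [hz, hz, Nat.add_mod, Nat.mod_eq_of_lt hlt, Nat.mod_eq_of_lt (by omega)]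
    exact phi_add_of_lt hlam0 hlam1 hmu hlt hrho1 (by omega)
  · have hm := Nat.mod_lt N hq
    rw [hz, hz, Nat.add_mod, Nat.mod_eq_of_lt hlt, Nat.mod_eq_sub_mod (by omega),
      Nat.mod_eq_of_lt (by omega)]
    exact phi_add_of_le hlam0 hlam1 hmu hlt hrho1 hm (by omega)

end TwoIntervalMap

theorem proposition6 (lam mu delta : ℝ) (p q : ℕ)
    (hlam0 : 0 < lam) (hlam1 : lam < 1) (hmu : 0 < mu)
    (hdelta0 : 1 - lam < delta) (hdelta1 : delta < dBound lam mu)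
    (hpq : Nat.Coprime p q)
    (hrho0 : 0 < (p : ℝ) / q) (hrho1 : (p : ℝ) / q < rBound lam mu)
    (hleft : deltaFunLeft lam mu ((p : ℝ) / q) ≤ delta)
    (hright : delta < deltaFun lam mu ((p : ℝ) / q)) :
    -- the left limits `f^l(1⁻)` exist and lie in `[0,1)`
    (∀ l : ℕ, 1 ≤ l →
      Tendsto ((affMap lam mu delta)^[l]) (𝓝[<] 1) (𝓝 (iterLeftOne lam mu delta l)) ∧
      iterLeftOne lam mu delta l ∈ Ico (0 : ℝ) 1) ∧
    -- location of the holes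
    (∀ l : ℕ, 1 ≤ l →
      hole lam mu delta l ⊆
        circIco (zeta lam mu delta p q ((l : ℤ) * p - 1)) (zeta lam mu delta p q ((l : ℤ) * p)) ∧
      zeta lam mu delta p q ((l : ℤ) * p - 1) =
        (affMap lam mu delta)^[l] (zeta lam mu delta p q ((q : ℤ) - 1)) ∧
      zeta lam mu delta p q ((l : ℤ) * p) =
        (affMap lam mu delta)^[l] (zeta lam mu delta p q 0) ∧
      (¬ q ∣ l → iterLeftOne lam mu delta l < (affMap lam mu delta)^[l] 0) ∧
      (q ∣ l → (affMap lam mu delta)^[l] 0 < iterLeftOne lam mu delta l)) ∧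
    -- the first `n` holes, for `n < q`
    (∀ n : ℕ, n ≤ q - 1 →
      (Icc 1 n).PairwiseDisjoint (hole lam mu delta) ∧
      (affMap lam mu delta)^[n] '' Ico 0 1 = Ico 0 1 \ ⋃ l ∈ Icc 1 n, hole lam mu delta l) ∧
    -- the last `q` holes, for `n ≥ q`
    (∀ n : ℕ, q ≤ n →
      (Icc (n - q + 1) n).PairwiseDisjoint (hole lam mu delta) ∧
      (affMap lam mu delta)^[n] '' Ico 0 1 =
        Ico 0 1 \ ⋃ l ∈ Icc (n - q + 1) n, hole lam mu delta l) ∧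
    -- the bound for the Lebesgue measure
    (∀ n : ℕ, volume ((affMap lam mu delta)^[n] '' Ico 0 1) ≤
      ENNReal.ofReal ((lam ^ q * mu ^ p) ^ (n / q))) := by
  have h := isRotationOrbit_zeta hlam0 hlam1 hmu hdelta0 hdelta1 hpq hrho0 hrho1 hleft hright
  have hq := h.q_pos
  have hfirst : ∀ l : ℕ, zeta lam mu delta p q ((l : ℤ) * p) =
      zeta lam mu delta p q ((l * p : ℕ) : ℤ) := fun l => by push_cast; rfl
  have hlast : ∀ l : ℕ, zeta lam mu delta p q ((l : ℤ) * p - 1) =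
      zeta lam mu delta p q ((q - 1 + l * p : ℕ) : ℤ) := fun l => by
    -- Adding the period `q` turns `lp - 1` into the natural index used for the orbit.
    have e : ((q - 1 + l * p : ℕ) : ℤ) = (l : ℤ) * p - 1 + q := by
      push_cast [Nat.cast_sub hq]; ring
    rw [zeta, zeta, e, Int.add_emod_right]
  refine ⟨fun l hl => ?_, fun l hl => ⟨?_, ?_, ?_, ?_, ?_⟩, fun n hn => ?_, fun n _ =>
    ⟨h.pairwiseDisjoint_hole n, h.image_iterate n⟩, h.volume_image_le⟩
  · rw [h.iterLeftOne_eq]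
    exact ⟨h.tendsto_iterate l, h.leftEnd_mem_Ico (by omega)⟩
  · rw [hfirst, hlast]
    exact h.hole_subset l
  · rw [hlast, ← h.iterate_orbit (q - 1) l, Nat.cast_sub hq, Nat.cast_one]
  · have := h.iterate_orbit 0 l
    rw [zero_add] at this
    rw [hfirst, ← this, Nat.cast_zero]
  · intro hd
    rw [h.iterLeftOne_eq, h.iterate_zero]
    exact h.leftEnd_lt_rightEnd hd
  · intro hd
    rw [h.iterLeftOne_eq, h.iterate_zero]
    exact h.rightEnd_lt_leftEnd hd
  · have h1 := h.pairwiseDisjoint_hole n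
    have h2 := h.image_iterate n
    -- For `n ≤ q` the truncated window of the last `q` holes is `Icc 1 n`.
    rw [Nat.sub_eq_zero_of_le (by omega : n ≤ q), zero_add] at h1 h2
    exact ⟨h1, h2⟩
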